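/- **Notation.** All groups are finite. $\psi^G$ denotes the induced character, $\operatorname{Irr}G$ the set of complex irreducible characters of $G$, $[G:H]$ the index, $N_G(H)$ the normalizer, and $x^g=g^{-1}xg$ for $x\in\mathbb{Q}G$, $g\in G$; the elements $x^g$ are the $G$-conjugates of $x$, and $\operatorname{Cen}_G(x)=\{g\in G \mid gx=xg\}$. For a subgroup $L\le G$, $\mathbb{Q}L$ is regarded as a subring of $\mathbb{Q}G$, and $\operatorname{Cen}_L(x)=L\cap\operatorname{Cen}_G(x)$. For $\chi\in\operatorname{Irr}G$, let $\mathbb{Q}(\chi)$ be the field generated over $\mathbb{Q}$ by the values of $\chi$ and $$e_{\mathbb{Q}}(\chi)=\frac{\chi(1)}{|G|}\sum_{\sigma\in\operatorname{Gal}(\mathbb{Q}(\chi)/\mathbb{Q})}\ \sum_{g\in G}\sigma(\chi(g))\,g^{-1}\in\mathbb{Q}G .$$ For $K\unlhd H\le G$ put $\widehat{H}=\frac1{|H|}\sum_{h\in H}h$; let $\varepsilon(H,K)=\widehat{K}$ if $H=K$, and otherwise $\varepsilon(H,K)=\prod_M(\widehat K-\widehat M)$, where $M$ runs over the minimal elements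 of the set of normal subgroups of $H$ that properly contain $K$. Let $e(G,H,K)$ be the sum of all the distinct $G$-conjugates of $\varepsilon(H,K)$. When there is a rational number $\alpha$ such that $\alpha\, e(G,H,K)$ is a primitive central idempotent of $\mathbb{Q}G$, it is unique and is denoted by $\alpha_{(G,H,K)}$. The same notation is used with $L$ in place of $G$ when $H\le L\le G$. **Proposition.** Let $G$ be a finite group, let $K\unlhd H\le G$ with $H/K$ cyclic, and let $\psi$ be a linear character of $H$ with kernel $K$. Suppose that $A$ is a normal subgroup of $G$ and $L$ a subgroup of $G$ such that $A\le H\le L$, the restriction $\psi_A$ of $\psi$ to $A$ is invariant in $L$, and $L\unlhd N_G(\ker\psi_A)$. Then the following hold. (i) If $\psi^L\in\operatorname{Irr}L$, then the distinct $G$-conjugates of $e_{\mathbb{Q}}(\psi^L)$ are mutually orthogonal. (ii) If $\psi^G\in\operatorname{Irr}G$ (in which case also $\psi^L\in\operatorname{Irr}L$, and $\alpha_{(G,H,K)}$ and $\alpha_{(L,H,K)}$ exist), then $e_{\mathbb{Q}}(\psi^G)$ is the sum of all the distinct $G$-conjugates of $e_{\mathbb{Q}}(\psi^L)$. Furthermore,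 $$\alpha_{(G,H,K)}=\alpha_{(L,H,K)}\,\frac{[\operatorname{Cen}_G(\varepsilon(H,K)):\operatorname{Cen}_L(\varepsilon(H,K))]}{[\operatorname{Cen}_G(e(L,H,K)):L]}.$$ -/

import Mathlib

namespace Shoda

noncomputable section

open scoped Classical in
/-- The class function induced to `G` from a function `f` on a subgroup `H`:
`f^G(g) = |H|⁻¹ ∑_{x ∈ G} f°(x g x⁻¹)`, where `f°` is `f` on `H` and `0` off `H`. -/
def inducedChar {G : Type*} [Group G] (H : Subgroup G) (f : H → ℂ) : G → ℂ := fun g =>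
  (Nat.card H : ℂ)⁻¹ * ∑ᶠ x : G, if hx : x * g * x⁻¹ ∈ H then f ⟨x * g * x⁻¹, hx⟩ else 0

/-- `χ ∈ Irr G`: `χ` is the character of an irreducible complex representation of `G`. -/
def IsIrrChar {G : Type*} [Group G] (χ : G → ℂ) : Prop :=
  ∃ (n : ℕ) (ρ : Representation ℂ G (Fin n → ℂ)), ρ.IsIrreducible ∧ χ = ρ.character

/-- The kernel in `G` of a linear character `ψ` of a subgroup `H` of `G`. -/
def linKer {G : Type*} [Group G] {H : Subgroup G} (ψ : H →* ℂˣ) : Subgroup G :=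
  ψ.ker.map H.subtype

/-- The restriction `ψ_A` of a linear character `ψ` of `H` to a subgroup `A ≤ H`. -/
def linRes {G : Type*} [Group G] {A H : Subgroup G} (hAH : A ≤ H) (ψ : H →* ℂˣ) : A →* ℂˣ :=
  ψ.comp (Subgroup.inclusion hAH)

/-- For `H ≤ L ≤ G`, a linear character of `H` regarded as a linear character of `H` as a
subgroup of the group `L`. -/
def linOn {G : Type*} [Group G] {H L : Subgroup G} (hHL : H ≤ L) (ψ : H →* ℂˣ) :
    (H.subgroupOf L) →* ℂˣ :=
  ψ.comp (Subgroup.subgroupOfEquivOfLe hHL).toMonoidHom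

/-- The character `ψ^G` of `G` induced from a linear character `ψ` of `H`. -/
def linInd {G : Type*} [Group G] {H : Subgroup G} (ψ : H →* ℂˣ) : G → ℂ :=
  inducedChar H (fun h => (ψ h : ℂ))

/-- A linear character `φ` of a normal subgroup `A` of `G` is invariant in `L`:
`φ(x a x⁻¹) = φ(a)` for `x ∈ L`, `a ∈ A`. -/
def IsInvariantIn {G : Type*} [Group G] {A : Subgroup G} (hA : A.Normal) (φ : A →* ℂˣ)
    (L : Subgroup G) : Prop :=
  ∀ x ∈ L, ∀ a : A, φ ⟨x * a * x⁻¹, hA.conj_mem a a.2 x⟩ = φ a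

/-- The field `ℚ(χ)` generated over `ℚ` by the values of `χ`. -/
abbrev charField {G : Type*} (χ : G → ℂ) : IntermediateField ℚ ℂ :=
  IntermediateField.adjoin ℚ (Set.range χ)

/-- The value `χ(g)` as an element of `ℚ(χ)`. -/
def charValue {G : Type*} (χ : G → ℂ) (g : G) : charField χ :=
  ⟨χ g, IntermediateField.subset_adjoin ℚ _ ⟨g, rfl⟩⟩

/-- The element `e_ℚ(χ) = |G|⁻¹ ∑_{g ∈ G} Tr(χ(1) χ(g)) g⁻¹` of `ℚG`, where
`Tr = ∑_{σ ∈ Gal(ℚ(χ)/ℚ)} σ` is the trace of `ℚ(χ)/ℚ`. See `eQ_eq_sum_galois` for the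
same formula with the sum over the Galois group written out. -/
def eQ {G : Type*} [Group G] (χ : G → ℂ) : MonoidAlgebra ℚ G :=
  (Nat.card G : ℚ)⁻¹ • ∑ᶠ g : G,
    MonoidAlgebra.single g⁻¹ (Algebra.trace ℚ (charField χ) (charValue χ 1 * charValue χ g))

/-- `Ĥ = |H|⁻¹ ∑_{h ∈ H} h` in `ℚG`. -/
def hat {G : Type*} [Group G] (H : Subgroup G) : MonoidAlgebra ℚ G :=
  (Nat.card H : ℚ)⁻¹ • ∑ᶠ h : H, MonoidAlgebra.single (h : G) (1 : ℚ)

/-- The minimal elements among the normal subgroups `M` of `H` that properly contain `K`. -/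
def minNormalAbove {G : Type*} [Group G] (H K : Subgroup G) : Set (Subgroup G) :=
  {M | Minimal (fun M : Subgroup G => M ≤ H ∧ (M.subgroupOf H).Normal ∧ K < M) M}

theorem single_mul_hat_comm {G : Type*} [Group G] [Finite G] {M H : Subgroup G} (hM : M ≤ H)
    (hn : (M.subgroupOf H).Normal) {x : G} (hx : x ∈ H) :
    Commute (MonoidAlgebra.single x (1 : ℚ)) (hat M) := by
  have := Fintype.ofFinite M
  have hc : ∀ y ∈ H, ∀ m ∈ M, y * m * y⁻¹ ∈ M := fun y hy m hm => by
    have := hn.conj_mem ⟨m, hM hm⟩ (by simpa [Subgroup.mem_subgroupOf] using hm) ⟨y, hy⟩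
    simpa [Subgroup.mem_subgroupOf] using this
  rw [Commute, SemiconjBy, hat, finsum_eq_sum_of_fintype, smul_mul_assoc, mul_smul_comm,
    Finset.sum_mul, Finset.mul_sum]
  congr 1
  let e : M ≃ M :=
    { toFun := fun m => ⟨x * m * x⁻¹, hc x hx m m.2⟩
      invFun := fun m => ⟨x⁻¹ * m * x, by simpa using hc x⁻¹ (H.inv_mem hx) m m.2⟩
      left_inv := fun m => by ext; simp [mul_assoc]
      right_inv := fun m => by ext; simp [mul_assoc] }
  refine Fintype.sum_equiv e _ _ fun h => ?_
  simp [e, MonoidAlgebra.single_mul_single]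

theorem commute_hat {G : Type*} [Group G] [Finite G] {M H N : Subgroup G} (hM : M ≤ H)
    (hn : (M.subgroupOf H).Normal) (hN : N ≤ H) : Commute (hat N) (hat M) := by
  have := Fintype.ofFinite N
  rw [hat, finsum_eq_sum_of_fintype]
  exact (Commute.sum_left _ _ _ fun h _ => single_mul_hat_comm hM hn (hN h.2)).smul_left _

theorem commute_factors {G : Type*} [Group G] [Finite G] {H K M N : Subgroup G}
    (hM : M ∈ minNormalAbove H K) (hN : N ∈ minNormalAbove H K) :
    Commute (hat K - hat M) (hat K - hat N) := by
  obtain ⟨⟨hM1, hM2, hM3⟩, -⟩ := hM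
  obtain ⟨⟨hN1, hN2, hN3⟩, -⟩ := hN
  have hK : K ≤ H := hM3.le.trans hM1
  exact ((Commute.refl _).sub_right (commute_hat hN1 hN2 hK)).sub_left
    ((commute_hat hM1 hM2 hK).symm.sub_right (commute_hat hN1 hN2 hM1))

open scoped Classical in
/-- `ε(H,K)`: it is `K̂` if `H = K`, and otherwise the product of the (pairwise commuting)
elements `K̂ - M̂` over all minimal normal subgroups `M` of `H` properly containing `K`. -/
def epsilon {G : Type*} [Group G] [Finite G] (H K : Subgroup G) : MonoidAlgebra ℚ G :=
  if H = K then hat K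
  else (Set.toFinite (minNormalAbove H K)).toFinset.noncommProd (fun M => hat K - hat M)
    (fun _ hM _ hN _ => commute_factors (by simpa using hM) (by simpa using hN))

/-- The conjugate `x^g = g⁻¹ x g` of an element `x` of `ℚG`. -/
def conj {G : Type*} [Group G] (x : MonoidAlgebra ℚ G) (g : G) : MonoidAlgebra ℚ G :=
  MonoidAlgebra.single g⁻¹ 1 * x * MonoidAlgebra.single g 1

/-- The set of all (distinct) `G`-conjugates of `x`. -/
def conjugates {G : Type*} [Group G] (x : MonoidAlgebra ℚ G) : Set (MonoidAlgebra ℚ G) :=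
  Set.range (conj x)

/-- The sum of all the distinct `G`-conjugates of `x`. -/
def conjSum {G : Type*} [Group G] (x : MonoidAlgebra ℚ G) : MonoidAlgebra ℚ G :=
  ∑ᶠ y ∈ conjugates x, y

/-- `e(G,H,K)`: the sum of all the distinct `G`-conjugates of `ε(H,K)`. -/
def eSum {G : Type*} [Group G] [Finite G] (H K : Subgroup G) : MonoidAlgebra ℚ G :=
  conjSum (epsilon H K)

/-- `e` is a primitive central idempotent of the ring `R`: a nonzero central idempotent that is
not the sum of two nonzero orthogonal central idempotents. -/
def IsPrimCentralIdem {R : Type*} [Ring R] (e : R) : Prop :=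
  e ∈ Set.center R ∧ IsIdempotentElem e ∧ e ≠ 0 ∧
    ∀ f g : R, f ∈ Set.center R → IsIdempotentElem f → g ∈ Set.center R → IsIdempotentElem g →
      f * g = 0 → e = f + g → f = 0 ∨ g = 0

open scoped Classical in
/-- `α_(G,H,K)`: the rational number `α` such that `α e(G,H,K)` is a primitive central idempotent
of `ℚG` (a junk value if there is none; there is at most one, see `alpha_eq`). -/
def alpha {G : Type*} [Group G] [Finite G] (H K : Subgroup G) : ℚ :=
  if h : ∃ a : ℚ, IsPrimCentralIdem (a • eSum H K) then h.choose else 0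

theorem alpha_eq {G : Type*} [Group G] [Finite G] {H K : Subgroup G} {a : ℚ}
    (ha : IsPrimCentralIdem (a • eSum H K)) : alpha H K = a := by
  have h : ∃ a : ℚ, IsPrimCentralIdem (a • eSum H K) := ⟨a, ha⟩
  have key : ∀ b : ℚ, IsPrimCentralIdem (b • eSum H K) →
      eSum H K ≠ 0 ∧ b ≠ 0 ∧ b • (eSum H K * eSum H K) = eSum H K := by
    rintro b ⟨-, hi, h0, -⟩
    have hb : b ≠ 0 := fun hb => h0 (by rw [hb, zero_smul])
    refine ⟨fun he => h0 (by rw [he, smul_zero]), hb, ?_⟩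
    rw [IsIdempotentElem, smul_mul_smul_comm, mul_smul] at hi
    exact smul_right_injective _ hb hi
  rw [alpha, dif_pos h]
  obtain ⟨he, hb, h1⟩ := key _ h.choose_spec
  obtain ⟨-, -, h2⟩ := key _ ha
  have hs : eSum H K * eSum H K ≠ 0 := fun h => he (by rw [← h1, h, smul_zero])
  exact smul_left_injective ℚ hs (h1.trans h2.symm)

/-- `Cen_G(x) = {g ∈ G | g x = x g}` for an element `x` of `ℚG`. -/
def cen {G : Type*} [Group G] (x : MonoidAlgebra ℚ G) : Subgroup G where
  carrier := {g | MonoidAlgebra.single g 1 * x = x * MonoidAlgebra.single g 1}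
  one_mem' := by simp [← MonoidAlgebra.one_def]
  mul_mem' {a b} ha hb := by
    have hab : (MonoidAlgebra.single (a * b) 1 : MonoidAlgebra ℚ G) =
        MonoidAlgebra.single a 1 * MonoidAlgebra.single b 1 := by
      simp [MonoidAlgebra.single_mul_single]
    simp only [Set.mem_ofPred_eq] at *
    rw [hab, mul_assoc, hb, ← mul_assoc, ha, mul_assoc]
  inv_mem' {a} ha := by
    have h1 : (MonoidAlgebra.single a⁻¹ 1 : MonoidAlgebra ℚ G) * MonoidAlgebra.single a 1 = 1 := by
      simp [MonoidAlgebra.single_mul_single, MonoidAlgebra.one_def]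
    have h2 : (MonoidAlgebra.single a 1 : MonoidAlgebra ℚ G) * MonoidAlgebra.single a⁻¹ 1 = 1 := by
      simp [MonoidAlgebra.single_mul_single, MonoidAlgebra.one_def]
    simp only [Set.mem_ofPred_eq] at *
    calc _ = MonoidAlgebra.single a⁻¹ 1 * (x * MonoidAlgebra.single a 1) *
          MonoidAlgebra.single a⁻¹ 1 := by rw [mul_assoc, mul_assoc x, h2, mul_one]
      _ = _ := by rw [← ha, ← mul_assoc, h1, one_mul]

/-- The inclusion `ℚL → ℚG` for a subgroup `L` of `G`. -/
def incl {G : Type*} [Group G] (L : Subgroup G) : MonoidAlgebra ℚ L →ₐ[ℚ] MonoidAlgebra ℚ G :=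
  MonoidAlgebra.mapDomainAlgHom ℚ ℚ L.subtype

/-- `ℚ(χ)/ℚ` is a Galois extension for an irreducible character `χ` of a finite group. -/
theorem charField_galois {G : Type*} [Group G] [Finite G] {χ : G → ℂ} (hχ : IsIrrChar χ) :
    FiniteDimensional ℚ (charField χ) ∧ IsGalois ℚ (charField χ) := by
  obtain ⟨n, ρ, -, rfl⟩ := hχ
  have hN : Nat.card G ≠ 0 := Nat.card_pos.ne'
  have : NeZero (Nat.card G) := ⟨hN⟩
  obtain ⟨ζ, hζ⟩ : ∃ ζ : ℂ, IsPrimitiveRoot ζ (Nat.card G) :=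
    ⟨_, Complex.isPrimitiveRoot_exp (Nat.card G) hN⟩
  let F : IntermediateField ℚ ℂ := IntermediateField.adjoin ℚ ({ζ} : Set ℂ)
  have : IsCyclotomicExtension {Nat.card G} ℚ F := by
    have halg : IsAlgebraic ℚ ζ := (hζ.isIntegral Nat.card_pos).tower_top.isAlgebraic
    change IsCyclotomicExtension {Nat.card G} ℚ (IntermediateField.adjoin ℚ {ζ}).toSubalgebra
    rw [IntermediateField.adjoin_simple_toSubalgebra_of_isAlgebraic halg]
    exact hζ.adjoin_isCyclotomicExtension ℚ
  have hab :
      @IsAbelianGalois ℚ F _ _ F.algebra' := IsCyclotomicExtension.isAbelianGalois {Nat.card G} ℚ F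
  have : FiniteDimensional ℚ F := IsCyclotomicExtension.finiteDimensional {Nat.card G} ℚ F
  have hle : charField ρ.character ≤ F := by
    rw [IntermediateField.adjoin_le_iff]
    rintro _ ⟨g, rfl⟩
    have ht : ρ.character g = ((ρ g).charpoly.roots).sum :=
      Module.End.trace_eq_sum_roots_charpoly_of_splits (IsAlgClosed.splits _)
    rw [ht]
    refine multiset_sum_mem _ fun μ hμ => ?_
    have hev : Module.End.HasEigenvalue (ρ g) μ := by
      rw [Module.End.hasEigenvalue_iff_isRoot_charpoly]
      exact (Polynomial.mem_roots'.1 hμ).2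
    obtain ⟨v, hv⟩ := hev.exists_hasEigenvector
    have h1 : ((ρ g) ^ Nat.card G) v = μ ^ Nat.card G • v := hv.pow_apply _
    rw [← map_pow, pow_card_eq_one', map_one, Module.End.one_apply] at h1
    have h2 : μ ^ Nat.card G = 1 := by
      have : (μ ^ Nat.card G - 1) • v = 0 := by rw [sub_smul, ← h1, one_smul, sub_self]
      exact sub_eq_zero.1 ((smul_eq_zero.1 this).resolve_right hv.2)
    obtain ⟨i, -, rfl⟩ := hζ.eq_pow_of_pow_eq_one h2
    exact pow_mem (IntermediateField.mem_adjoin_simple_self ℚ ζ) i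
  have : IsAbelianGalois ℚ (charField ρ.character) :=
    IsAbelianGalois.of_algHom (IntermediateField.inclusion hle)
  exact ⟨FiniteDimensional.of_injective (IntermediateField.inclusion hle).toLinearMap
    (IntermediateField.inclusion hle).injective, inferInstance⟩

/-- For `χ ∈ Irr G`, `e_ℚ(χ) = χ(1)|G|⁻¹ ∑_{σ ∈ Gal(ℚ(χ)/ℚ)} ∑_{g ∈ G} σ(χ(g)) g⁻¹` in `ℂG`. -/
theorem eQ_eq_sum_galois {G : Type*} [Group G] [Finite G] {χ : G → ℂ} (hχ : IsIrrChar χ) :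
    MonoidAlgebra.mapRingHom G (algebraMap ℚ ℂ) (eQ χ) = (χ 1 / (Nat.card G : ℂ)) •
      ∑ᶠ σ : Gal(charField χ/ℚ), ∑ᶠ g : G,
        MonoidAlgebra.single g⁻¹ ((σ (charValue χ g) : charField χ) : ℂ) := by
  obtain ⟨hf, hg⟩ := charField_galois hχ
  have := Fintype.ofFinite G
  have hone : ∃ d : ℕ, charValue χ 1 = (d : charField χ) := by
    obtain ⟨n, ρ, -, rfl⟩ := hχ
    exact ⟨n, Subtype.ext (by simp [charValue, Representation.char_one])⟩
  obtain ⟨d, hd⟩ := hone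
  have hd' : χ 1 = (d : ℂ) := by
    simpa [charValue] using congrArg (Subtype.val) hd
  simp only [finsum_eq_sum_of_fintype, eQ]
  have htr : ∀ g, (algebraMap ℚ ℂ) (Algebra.trace ℚ (charField χ)
      (charValue χ 1 * charValue χ g)) =
      χ 1 * ∑ σ : Gal(charField χ/ℚ), ((σ (charValue χ g) : charField χ) : ℂ) := by
    intro g
    rw [IsScalarTower.algebraMap_apply ℚ (charField χ) ℂ, trace_eq_sum_automorphisms, hd, hd']
    simp [Finset.mul_sum]
  rw [Finset.sum_comm]
  have hinner : ∀ g : G, ∑ σ : Gal(charField χ/ℚ), MonoidAlgebra.single g⁻¹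
      ((σ (charValue χ g) : charField χ) : ℂ) = MonoidAlgebra.single g⁻¹
      (∑ σ : Gal(charField χ/ℚ), ((σ (charValue χ g) : charField χ) : ℂ)) := fun g =>
    (map_sum (MonoidAlgebra.singleAddHom g⁻¹) _ _).symm
  simp only [hinner, Finset.smul_sum, map_sum]
  refine Finset.sum_congr rfl fun g _ => ?_
  rw [MonoidAlgebra.smul_single, MonoidAlgebra.smul_single, MonoidAlgebra.mapRingHom_single,
    smul_eq_mul, map_mul, htr]
  congr 1
  simp
  ring

end

end Shoda

/-! Write `n` for the order of the image of `ψ`, and `e` for `eQ` of the character that `ψ` induces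
to `L`, viewed in `ℚG`.

Linear characters and `ε`: over `ℂ`, `hat K` is the sum of the idempotents of all powers of `ψ`.
Multiplying by `ε(H,K)` keeps exactly the faithful ones modulo `K`, the `ψ ^ j` with `j` prime to
`n` (`toC_epsilon`). The coefficients of `ε(H,K)` are therefore traces from `ℚ(ζₙ)`, up to the
factor `1/|H|`. Comparing these with the traces defining `eQ` of the induced character gives a
rational `c` with `eQ(ψ^G) = c ∑_g ε(H,K)^g` (`exists_eQ_linInd`). Since each distinct conjugate
occurs `|Cen_G(ε)|` times in that sum, and `eQ` of an irreducible character is a primitive central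
idempotent, `α_G = c |Cen_G(ε)|`. In the same way `α_L = d |Cen_L(ε)|`, with `d` the constant for
`L`.

Orthogonality: let `U` be the kernel of `ψ_A`. If `g` does not normalize `U`, then `e^g` absorbs
`U^g` on the right, while summing over `U^g` kills `e`, because `ψ_A` is nontrivial on `U^g`; so
`e^g e = 0`. If `g` normalizes `U`, it normalizes `L`, so `e^g` is again a central idempotent of
`ℚL` and primitivity of `e` decides the product.

Conclusion: summing `ε` over `L`-conjugates and then over `G` shows that the sum of the distinct
conjugates of `e` is `r eQ(ψ^G)` with `r = d|L| / (c|Cen_G(e)|)`. By orthogonality this sum is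
idempotent, and it is nonzero, so `r = 1`. This is the claimed identity, and it also gives `c/d =
1/[Cen_G(e):L]`, whence the formula for `α`. Irreducibility of `ψ^L` follows from that of `ψ^G` by
Mackey's criterion (`mackey_eq_zero`, `isIrrChar_linInd_of_mackey`). -/

namespace Shoda

noncomputable section

/-! ### Coefficients and conjugation in the group algebra. -/

section GroupAlgebra

/-- The element of the group algebra with a prescribed coefficient function. -/
def ofFun {G R : Type*} [Semiring R] [Finite G] (f : G → R) : MonoidAlgebra R G :=
  MonoidAlgebra.ofCoeff (Finsupp.equivFunOnFinite.symm f)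

@[simp]
theorem coeff_ofFun {G R : Type*} [Semiring R] [Finite G] (f : G → R) (g : G) :
    (ofFun f).coeff g = f g := rfl

theorem ext_coeff {G R : Type*} [Semiring R] {x y : MonoidAlgebra R G}
    (h : ∀ g, x.coeff g = y.coeff g) : x = y :=
  MonoidAlgebra.coeff_injective (Finsupp.ext h)

variable {G : Type*} [Group G]

theorem coeff_mul_sum {R : Type*} [Semiring R] [Fintype G] (x y : MonoidAlgebra R G) (g : G) :
    (x * y).coeff g = ∑ k, x.coeff k * y.coeff (k⁻¹ * g) := by
  rw [MonoidAlgebra.coeff_mul_apply_left, Finsupp.sum_fintype _ _ (by simp)]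

theorem coeff_conj (x : MonoidAlgebra ℚ G) (g k : G) :
    (conj x g).coeff k = x.coeff (g * k * g⁻¹) := by
  rw [conj, MonoidAlgebra.coeff_mul_single_apply, MonoidAlgebra.coeff_single_mul_apply]
  simp [mul_assoc]

theorem conj_conj (x : MonoidAlgebra ℚ G) (a b : G) : conj (conj x a) b = conj x (a * b) :=
  ext_coeff fun k => by simp [coeff_conj, mul_assoc]

theorem conj_one (x : MonoidAlgebra ℚ G) : conj x 1 = x :=
  ext_coeff fun k => by simp [coeff_conj]

theorem conj_mul (x y : MonoidAlgebra ℚ G) (g : G) : conj (x * y) g = conj x g * conj y g := by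
  have h : (MonoidAlgebra.single g 1 : MonoidAlgebra ℚ G) * MonoidAlgebra.single g⁻¹ 1 = 1 := by
    simp [MonoidAlgebra.single_mul_single, MonoidAlgebra.one_def]
  simp only [conj]
  calc _ = MonoidAlgebra.single g⁻¹ 1 * x * 1 * y * MonoidAlgebra.single g 1 := by
        simp only [mul_one, mul_assoc]
    _ = _ := by rw [← h]; simp only [mul_assoc]

theorem conj_smul (c : ℚ) (x : MonoidAlgebra ℚ G) (g : G) : conj (c • x) g = c • conj x g := by
  simp [conj]

theorem conj_zero (g : G) : conj (0 : MonoidAlgebra ℚ G) g = 0 := by simp [conj]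

theorem conj_sum {ι : Type*} (s : Finset ι) (f : ι → MonoidAlgebra ℚ G) (g : G) :
    conj (∑ i ∈ s, f i) g = ∑ i ∈ s, conj (f i) g := by
  simp [conj, Finset.mul_sum, Finset.sum_mul]

theorem single_mul_conj (x : MonoidAlgebra ℚ G) (g : G) :
    MonoidAlgebra.single g 1 * conj x g = x * MonoidAlgebra.single g 1 := by
  have h : (MonoidAlgebra.single g 1 : MonoidAlgebra ℚ G) * MonoidAlgebra.single g⁻¹ 1 = 1 := by
    simp [MonoidAlgebra.single_mul_single, MonoidAlgebra.one_def]
  rw [conj, ← mul_assoc, ← mul_assoc, h, one_mul]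

theorem mem_cen_iff {x : MonoidAlgebra ℚ G} {g : G} : g ∈ cen x ↔ conj x g = x := by
  change MonoidAlgebra.single g 1 * x = x * MonoidAlgebra.single g 1 ↔ _
  have hu : IsUnit (MonoidAlgebra.single g 1 : MonoidAlgebra ℚ G) :=
    (Group.isUnit g).map (MonoidAlgebra.of ℚ G)
  rw [← single_mul_conj, hu.mul_right_inj, eq_comm]

theorem cen_smul {c : ℚ} (hc : c ≠ 0) (x : MonoidAlgebra ℚ G) : cen (c • x) = cen x := by
  ext g
  rw [mem_cen_iff, mem_cen_iff, conj_smul, (smul_right_injective _ hc).eq_iff]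

theorem mem_center_iff_conj {x : MonoidAlgebra ℚ G} :
    x ∈ Set.center (MonoidAlgebra ℚ G) ↔ ∀ g, conj x g = x := by
  rw [Semigroup.mem_center_iff]
  constructor
  · exact fun h g => mem_cen_iff.1 (h _)
  · intro h y
    induction y using MonoidAlgebra.induction_linear with
    | zero => simp
    | add a b ha hb => rw [add_mul, mul_add, ha, hb]
    | single g r =>
      have := mem_cen_iff.2 (h g)
      change MonoidAlgebra.single g 1 * x = x * MonoidAlgebra.single g 1 at this
      have hs : (MonoidAlgebra.single g r : MonoidAlgebra ℚ G) =
          r • MonoidAlgebra.single g 1 := by simp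
      rw [hs, smul_mul_assoc, mul_smul_comm, this]

theorem conj_eq_conj_iff {x : MonoidAlgebra ℚ G} {a b : G} :
    conj x a = conj x b ↔ a * b⁻¹ ∈ cen x := by
  rw [mem_cen_iff]
  constructor
  · intro h
    rw [← conj_conj, h, conj_conj, mul_inv_cancel, conj_one]
  · intro h
    conv_rhs => rw [← h]
    rw [conj_conj, inv_mul_cancel_right]

variable [Finite G]

theorem conjugates_finite (x : MonoidAlgebra ℚ G) : (conjugates x).Finite := Set.finite_range _

/-- Orbit-stabilizer: the fibre of `g ↦ x^g` over `x^b` is the coset `cen x * b`. This trades sums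
over distinct conjugates for sums over the whole group. -/
theorem sum_conj_eq [Fintype G] (x : MonoidAlgebra ℚ G) :
    ∑ g, conj x g = (Nat.card (cen x) : ℚ) • conjSum x := by
  classical
  rw [conjSum, finsum_mem_eq_finite_toFinset_sum _ (conjugates_finite x),
    ← Finset.sum_fiberwise_of_maps_to (t := (conjugates_finite x).toFinset) (g := conj x)
      (fun g _ => by simp [conjugates]), Finset.smul_sum]
  refine Finset.sum_congr rfl fun y hy => ?_
  obtain ⟨b, rfl⟩ : y ∈ conjugates x := by simpa using hy
  rw [Finset.sum_congr rfl (fun g hg => (Finset.mem_filter.1 hg).2), Finset.sum_const,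
    Nat.cast_smul_eq_nsmul]
  congr 1
  rw [← Fintype.card_subtype, ← Nat.card_eq_fintype_card]
  refine Nat.card_congr
    { toFun := fun g => ⟨g * b⁻¹, conj_eq_conj_iff.1 g.2⟩
      invFun := fun c => ⟨c * b, conj_eq_conj_iff.2 (by simp)⟩
      left_inv := fun g => by simp
      right_inv := fun c => by simp }

end GroupAlgebra

/-! ### The embedding of `ℚL` in `ℚG`. -/

section Inclusion

variable {G : Type*} [Group G] {L : Subgroup G}

theorem incl_injective : Function.Injective (incl L) := by
  intro x y h
  have := MonoidAlgebra.mapDomain_injective (R := ℚ) L.subtype_injective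
  exact this h

theorem coeff_incl (x : MonoidAlgebra ℚ L) (l : L) : (incl L x).coeff l = x.coeff l := by
  have h : (incl L x).coeff = Finsupp.mapDomain L.subtype x.coeff := rfl
  rw [h]
  exact Finsupp.mapDomain_apply L.subtype_injective _ _

theorem coeff_incl_of_notMem (x : MonoidAlgebra ℚ L) {g : G} (hg : g ∉ L) :
    (incl L x).coeff g = 0 := by
  have h : (incl L x).coeff = Finsupp.mapDomain L.subtype x.coeff := rfl
  rw [h]
  exact Finsupp.mapDomain_of_notMem_range _ _ (by simpa using hg)

theorem incl_conj (x : MonoidAlgebra ℚ L) (l : L) :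
    incl L (conj x l) = conj (incl L x) (l : G) := by
  have h : ∀ k : L, incl L (MonoidAlgebra.single k 1) = MonoidAlgebra.single (k : G) 1 := fun k =>
    MonoidAlgebra.mapDomain_single
  simp [conj, map_mul, h]

theorem mem_cen_incl {x : MonoidAlgebra ℚ L} {l : L} : (l : G) ∈ cen (incl L x) ↔ l ∈ cen x := by
  rw [mem_cen_iff, mem_cen_iff, ← incl_conj, incl_injective.eq_iff]

theorem exists_incl_eq [Finite G] {z : MonoidAlgebra ℚ G} (hz : ∀ g ∉ L, z.coeff g = 0) :
    ∃ w, incl L w = z := by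
  refine ⟨ofFun fun l => z.coeff l, ext_coeff fun g => ?_⟩
  by_cases hg : g ∈ L
  · exact coeff_incl _ ⟨g, hg⟩
  · rw [coeff_incl_of_notMem _ hg, hz g hg]

end Inclusion

/-! ### Irreducible characters: norm and Schur's lemma. -/

section Characters

variable {G : Type*} [Group G]

/-- A class function with values in an arbitrary type. -/
def IsClassFun {R : Type*} (f : G → R) : Prop := ∀ g k, f (g * k * g⁻¹) = f k

theorem IsIrrChar.isClassFun {χ : G → ℂ} (hχ : IsIrrChar χ) : IsClassFun χ := by
  obtain ⟨n, ρ, -, rfl⟩ := hχ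
  exact fun g k => ρ.char_conj k g

theorem IsIrrChar.exists_natCast {χ : G → ℂ} (hχ : IsIrrChar χ) : ∃ d : ℕ, d ≠ 0 ∧ χ 1 = d := by
  obtain ⟨n, ρ, hρ, rfl⟩ := hχ
  refine ⟨n, ?_, by simp⟩
  rintro rfl
  obtain ⟨a, b, hab⟩ := hρ.toNontrivial
  exact hab (Subrepresentation.toSubmodule_injective (Subsingleton.elim _ _))

theorem IsIrrChar.sum_mul_inv [Fintype G] {χ : G → ℂ} (hχ : IsIrrChar χ) :
    ∑ g, χ g * χ g⁻¹ = Nat.card G := by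
  obtain ⟨n, ρ, hρ, rfl⟩ := hχ
  have h0 : (Nat.card G : ℂ) ≠ 0 := by exact_mod_cast Nat.card_pos.ne'
  have := invertibleOfNonzero h0
  have h := Representation.card_inv_mul_sum_char_mul_char_eq_finrank ρ ρ
  rw [Representation.IsIrreducible.finrank_intertwiningMap_self, Nat.cast_one,
    inv_mul_eq_one₀ h0] at h
  exact h.symm

/-- Schur's lemma: a class function acts by a scalar on the translates of an irreducible
character. -/
theorem IsIrrChar.exists_scalar [Fintype G] {χ : G → ℂ} (hχ : IsIrrChar χ) {f : G → ℂ}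
    (hf : IsClassFun f) : ∃ ω : ℂ, ∀ g, ∑ x, f x * χ (g * x) = ω * χ g := by
  obtain ⟨n, ρ, hρ, rfl⟩ := hχ
  let T : Representation.IntertwiningMap ρ ρ :=
    { toLinearMap := ∑ x, f x • ρ x
      isIntertwining' := by
        intro g
        refine LinearMap.ext fun v => ?_
        simp only [LinearMap.comp_apply, LinearMap.sum_apply, LinearMap.smul_apply, map_sum,
          map_smul]
        refine Fintype.sum_equiv (MulAut.conj g⁻¹).toEquiv _ _ fun x => ?_
        have := hf g⁻¹ x
        rw [inv_inv] at this
        simp [mul_assoc, ← this, ← Module.End.mul_apply, ← map_mul] }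
  obtain ⟨ω, hω⟩ :=
    (Representation.IsIrreducible.algebraMap_intertwiningMap_bijective_of_isAlgClosed
      (ρ := ρ)).2 T
  have hT : ∑ x, f x • ρ x = ω • (1 : Module.End ℂ (Fin n → ℂ)) := by
    have := congrArg (fun S : Representation.IntertwiningMap ρ ρ => S.toLinearMap) hω
    exact this.symm
  refine ⟨ω, fun g => ?_⟩
  have h2 := congrArg (fun S => LinearMap.trace ℂ (Fin n → ℂ) (ρ g * S)) hT
  simpa [Finset.mul_sum, Representation.character, map_mul] using h2

end Characters

/-! ### `eQ` of an irreducible character is a primitive central idempotent. -/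

section GaloisOrbit

variable {G : Type*} [Group G] {χ : G → ℂ}

theorem coeff_mapRingHom {R S : Type*} [Semiring R] [Semiring S] (f : R →+* S)
    (x : MonoidAlgebra R G) (g : G) : (MonoidAlgebra.mapRingHom G f x).coeff g = f (x.coeff g) := by
  rfl

theorem IsIrrChar.isClassFun_charValue (hχ : IsIrrChar χ) : IsClassFun (charValue χ) :=
  fun g k => Subtype.ext (hχ.isClassFun g k)

theorem IsIrrChar.charValue_one_ne_zero (hχ : IsIrrChar χ) : charValue χ 1 ≠ 0 := by
  obtain ⟨d, hd, h1⟩ := hχ.exists_natCast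
  intro h
  have := congrArg Subtype.val h
  simp [charValue, h1, hd] at this

theorem mapRingHom_algebraMap_injective {F : Type*} [Field F] [Algebra ℚ F] :
    Function.Injective (MonoidAlgebra.mapRingHom G (algebraMap ℚ F)) := fun _ _ h =>
  ext_coeff fun g => (algebraMap ℚ F).injective (congrArg (fun z => z.coeff g) h)

variable [Fintype G]

/-- The idempotent `χ(1)|G|⁻¹ ∑ χ(g) g⁻¹` over the field of values of `χ`. -/
def eF (χ : G → ℂ) : MonoidAlgebra (charField χ) G :=
  ofFun fun g => charValue χ 1 / (Nat.card G : charField χ) * charValue χ g⁻¹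

/-- The Galois conjugates of `eF χ`. -/
def eGal (χ : G → ℂ) (σ : Gal(charField χ/ℚ)) : MonoidAlgebra (charField χ) G :=
  MonoidAlgebra.mapRingHom G (σ : charField χ →+* charField χ) (eF χ)

theorem IsClassFun.commute {R : Type*} [CommSemiring R] {z : MonoidAlgebra R G}
    (hz : IsClassFun fun g => z.coeff g) (y : MonoidAlgebra R G) : z * y = y * z := by
  refine ext_coeff fun g => ?_
  rw [coeff_mul_sum, coeff_mul_sum]
  refine Fintype.sum_equiv ((Equiv.inv G).trans (Equiv.mulRight g)) _ _ fun k => ?_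
  have := hz g⁻¹ k
  simp only [inv_inv] at this
  simp only [Equiv.trans_apply, Equiv.inv_apply, Equiv.coe_mulRight, ← this, mul_inv_rev, inv_inv,
    mul_assoc]
  exact mul_comm _ _

/-- The Schur scalar descends to `ℚ(χ)`: evaluating at `1` expresses it through `f`, the values of
`χ` and the degree. -/
theorem IsIrrChar.charValue_mul_sum (hχ : IsIrrChar χ) {f : G → charField χ} (hf : IsClassFun f) :
    ∃ ω : charField χ, ∀ g, ∑ x, f x * charValue χ (g * x) = ω * charValue χ g := by
  obtain ⟨ω, hω⟩ := hχ.exists_scalar (f := fun x => (f x : ℂ))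
    (fun g k => congrArg Subtype.val (hf g k))
  obtain ⟨d, hd, h1⟩ := hχ.exists_natCast
  have hd' : (d : ℂ) ≠ 0 := by exact_mod_cast hd
  have hω1 : ω = ((∑ x, f x * charValue χ x) / (d : charField χ) : charField χ) := by
    have := hω 1
    simp only [one_mul, h1] at this
    rw [eq_comm, ← eq_div_iff hd'] at this
    rw [this]
    simp [charValue]
  refine ⟨(∑ x, f x * charValue χ x) / (d : charField χ), fun g => Subtype.ext ?_⟩
  have := hω g
  rw [hω1] at this
  simpa [charValue] using this

theorem IsIrrChar.exists_mul_eF (hχ : IsIrrChar χ) {z : MonoidAlgebra (charField χ) G}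
    (hz : IsClassFun fun g => z.coeff g) : ∃ ω : charField χ, z * eF χ = ω • eF χ := by
  obtain ⟨ω, hω⟩ := hχ.charValue_mul_sum hz
  refine ⟨ω, ext_coeff fun g => ?_⟩
  have := hω g⁻¹
  rw [coeff_mul_sum, MonoidAlgebra.coeff_smul_apply, smul_eq_mul]
  simp only [eF, coeff_ofFun, mul_inv_rev, inv_inv]
  rw [mul_left_comm, ← this, Finset.mul_sum]
  exact Finset.sum_congr rfl fun _ _ => by ring

theorem IsIrrChar.isClassFun_eGal (hχ : IsIrrChar χ) (σ : Gal(charField χ/ℚ)) :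
    IsClassFun fun g => (eGal χ σ).coeff g := by
  intro g k
  have := hχ.isClassFun_charValue g k⁻¹
  simp only [eGal, coeff_mapRingHom, eF, coeff_ofFun]
  rw [← this]
  simp [mul_assoc]

theorem eGal_one (χ : G → ℂ) : eGal χ 1 = eF χ := ext_coeff fun _ => rfl

theorem map_eGal (χ : G → ℂ) (σ τ : Gal(charField χ/ℚ)) :
    MonoidAlgebra.mapRingHom G (σ : charField χ →+* charField χ) (eGal χ τ) = eGal χ (σ * τ) :=
  ext_coeff fun _ => rfl

theorem card_ne_zero_charField : (Nat.card G : charField χ) ≠ 0 := by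
  exact_mod_cast Nat.card_pos.ne'

theorem IsIrrChar.eF_ne_zero (hχ : IsIrrChar χ) : eF χ ≠ 0 := by
  intro h
  have := congrArg (fun x => x.coeff 1) h
  simp [eF, hχ.charValue_one_ne_zero] at this

/-- By Schur the square is a scalar multiple of `eF χ`; comparing coefficients at `1` and using that
`χ` has norm one shows the scalar is `1`. -/
theorem IsIrrChar.eF_mul_self (hχ : IsIrrChar χ) : eF χ * eF χ = eF χ := by
  obtain ⟨ω, hω⟩ := hχ.exists_mul_eF (z := eF χ) (by simpa [eGal_one] using hχ.isClassFun_eGal 1)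
  have h1 := congrArg (fun x => x.coeff 1) hω
  have hsum : ∑ k : G, charValue χ k * charValue χ k⁻¹ = (Nat.card G : charField χ) :=
    Subtype.ext (by simpa [charValue] using hχ.sum_mul_inv)
  have hne := hχ.charValue_one_ne_zero
  have hc := card_ne_zero_charField (G := G) (χ := χ)
  simp only [coeff_mul_sum, MonoidAlgebra.coeff_smul_apply, eF, coeff_ofFun, inv_one, mul_one,
    inv_inv, smul_eq_mul] at h1
  have h2 : ∑ k : G, charValue χ 1 / (Nat.card G : charField χ) * charValue χ k⁻¹ *
      (charValue χ 1 / (Nat.card G : charField χ) * charValue χ k) =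
      (charValue χ 1 / (Nat.card G : charField χ)) ^ 2 * (Nat.card G : charField χ) := by
    rw [← hsum, Finset.mul_sum]
    exact Finset.sum_congr rfl fun _ _ => by ring
  rw [h2] at h1
  have : ω = 1 := by
    field_simp at h1
    exact h1.symm
  rw [hω, this, one_smul]

/-- The product of these two central idempotents is a scalar multiple of each factor. If it were
nonzero the factors would coincide, so `τ` would fix every value of `χ`, hence all of `ℚ(χ)`. -/
theorem IsIrrChar.eF_mul_eGal (hχ : IsIrrChar χ) {τ : Gal(charField χ/ℚ)} (hτ : τ ≠ 1) :
    eF χ * eGal χ τ = 0 := by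
  obtain ⟨a, ha⟩ := hχ.exists_mul_eF (hχ.isClassFun_eGal τ)
  rw [(hχ.isClassFun_eGal τ).commute] at ha
  -- Schur is available only for products with `eF χ`, so it is used with `τ⁻¹` and the result is
  -- moved by `τ`, making the product a multiple of `eGal χ τ`.
  obtain ⟨b, hb⟩ := hχ.exists_mul_eF (hχ.isClassFun_eGal τ⁻¹)
  have hb' := congrArg (MonoidAlgebra.mapRingHom G (τ : charField χ →+* charField χ)) hb
  have hbs : ∀ c : charField χ, MonoidAlgebra.mapRingHom G (τ : charField χ →+* charField χ)
      (c • eF χ) = τ c • eGal χ τ := fun c => ext_coeff fun g => map_mul τ _ _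
  rw [map_mul, map_eGal, mul_inv_cancel, eGal_one, hbs] at hb'
  change eF χ * eGal χ τ = _ at hb'
  have hi : eGal χ τ * eGal χ τ = eGal χ τ := by rw [eGal, ← map_mul, hχ.eF_mul_self]
  have hne : eGal χ τ ≠ 0 := by
    intro h
    have := congrArg (MonoidAlgebra.mapRingHom G
      ((τ⁻¹ : Gal(charField χ/ℚ)) : charField χ →+* charField χ)) h
    rw [map_eGal, inv_mul_cancel, eGal_one, map_zero] at this
    exact hχ.eF_ne_zero this
  have h1 : (a * a) • eF χ = a • eF χ := by
    rw [mul_smul, ← ha, ← smul_mul_assoc, ← ha, mul_assoc, hi]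
  have h2 : (τ b * τ b) • eGal χ τ = τ b • eGal χ τ := by
    rw [mul_smul, ← hb', ← mul_smul_comm, ← hb', ← mul_assoc, hχ.eF_mul_self]
  have inj : ∀ {x : MonoidAlgebra (charField χ) G}, x ≠ 0 → ∀ {c d : charField χ},
      c • x = d • x → c = d := fun {x} hx {c d} h => by
    obtain ⟨g, hg⟩ : ∃ g, x.coeff g ≠ 0 := by
      by_contra! hc
      exact hx (ext_coeff hc)
    have := congrArg (fun y => y.coeff g) h
    simpa [hg] using this
  have h1' := inj hχ.eF_ne_zero h1
  have h2' := inj hne h2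
  by_cases ha0 : a = 0
  · rw [ha, ha0, zero_smul]
  have ha1 : a = 1 := by simpa [ha0] using h1'
  have hb1 : τ b = 1 := by
    have : τ b ≠ 0 := fun h => hχ.eF_ne_zero (by
      rw [h, zero_smul] at hb'
      rw [hb', ha1, one_smul] at ha
      exact ha.symm)
    simpa [this] using h2'
  have he : eF χ = eGal χ τ := by
    rw [← one_smul (charField χ) (eF χ), ← ha1, ← ha, hb', hb1, one_smul]
  obtain ⟨d, hd, hd1⟩ := hχ.exists_natCast
  have hv1 : charValue χ 1 = (d : charField χ) := Subtype.ext (by simpa [charValue] using hd1)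
  have hfix : ∀ g, τ (charValue χ g) = charValue χ g := by
    intro g
    have h := congrArg (fun y => y.coeff g⁻¹) he
    have hc := card_ne_zero_charField (G := G) (χ := χ)
    have hd0 : (d : charField χ) ≠ 0 := by exact_mod_cast hd
    simp only [eGal, coeff_mapRingHom, eF, coeff_ofFun, inv_inv, hv1, RingHom.coe_coe, map_mul,
      map_div₀, map_natCast] at h
    exact (mul_left_cancel₀ (div_ne_zero hd0 hc) h).symm
  refine absurd ?_ hτ
  -- The fixed field of `⟨τ⟩`, lifted to `ℂ`, contains the generators of `ℚ(χ)`.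
  have hle : charField χ ≤
      IntermediateField.lift (IntermediateField.fixedField (Subgroup.zpowers τ)) := by
    rw [IntermediateField.adjoin_le_iff]
    rintro _ ⟨g, rfl⟩
    rw [SetLike.mem_coe]
    refine (IntermediateField.mem_lift (charValue χ g)).2 ?_
    rw [IntermediateField.mem_fixedField_iff]
    intro f hf
    obtain ⟨k, rfl⟩ := Subgroup.mem_zpowers_iff.1 hf
    exact (Subgroup.zpow_mem (MulAction.stabilizer Gal(charField χ/ℚ) (charValue χ g))
      (MulAction.mem_stabilizer_iff.2 (hfix g)) k)
  ext1 y
  have := (IntermediateField.mem_lift y).1 (hle y.2)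
  rw [IntermediateField.mem_fixedField_iff] at this
  exact this τ (Subgroup.mem_zpowers τ)

theorem eQ_coeff (χ : G → ℂ) (g : G) : (eQ χ).coeff g = (Nat.card G : ℚ)⁻¹ *
    Algebra.trace ℚ (charField χ) (charValue χ 1 * charValue χ g⁻¹) := by
  classical
  rw [eQ, MonoidAlgebra.coeff_smul_apply, smul_eq_mul, finsum_eq_sum_of_fintype,
    MonoidAlgebra.coeff_sum, Finsupp.finsetSum_apply, Finset.sum_eq_single g⁻¹]
  · simp
  · intro b _ hb
    rw [MonoidAlgebra.coeff_single, Finsupp.single_apply, if_neg]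
    rintro rfl
    simp at hb
  · simp

theorem IsIrrChar.map_eQ (hχ : IsIrrChar χ) [ft : Fintype Gal(charField χ/ℚ)] :
    MonoidAlgebra.mapRingHom G (algebraMap ℚ (charField χ)) (eQ χ) = ∑ σ, eGal χ σ := by
  obtain ⟨hf, hg⟩ := charField_galois hχ
  obtain rfl : ft = AlgEquiv.fintype ℚ (charField χ) := Subsingleton.elim _ _
  refine ext_coeff fun g => ?_
  rw [MonoidAlgebra.coeff_sum, Finsupp.finsetSum_apply, coeff_mapRingHom, eQ_coeff, map_mul,
    trace_eq_sum_automorphisms, Finset.mul_sum]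
  obtain ⟨d, hd, hd1⟩ := hχ.exists_natCast
  have hv1 : charValue χ 1 = (d : charField χ) := Subtype.ext (by simpa [charValue] using hd1)
  refine Fintype.sum_equiv (Equiv.refl _) _ _ fun σ => ?_
  simp only [eGal, coeff_mapRingHom, eF, coeff_ofFun, hv1, RingHom.coe_coe, map_mul, map_div₀,
    map_natCast, map_inv₀, Equiv.refl_apply]
  ring

theorem IsIrrChar.isIdempotentElem_eQ (hχ : IsIrrChar χ) : IsIdempotentElem (eQ χ) := by
  obtain ⟨hf, hg⟩ := charField_galois hχ
  have := Fintype.ofFinite Gal(charField χ/ℚ)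
  classical
  apply mapRingHom_algebraMap_injective (F := charField χ)
  rw [map_mul, hχ.map_eQ, Finset.sum_mul]
  refine Finset.sum_congr rfl fun σ _ => ?_
  rw [Finset.mul_sum, Finset.sum_eq_single σ]
  · rw [eGal, ← map_mul, hχ.eF_mul_self]
  · intro τ _ hτ
    have h : σ⁻¹ * τ ≠ 1 := fun h => hτ (inv_mul_eq_one.1 h).symm
    have := congrArg (MonoidAlgebra.mapRingHom G (σ : charField χ →+* charField χ))
      (hχ.eF_mul_eGal h)
    rwa [map_mul, map_eGal, mul_inv_cancel_left, map_zero] at this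
  · simp

theorem IsIrrChar.conj_eQ (hχ : IsIrrChar χ) (g : G) : conj (eQ χ) g = eQ χ := by
  refine ext_coeff fun k => ?_
  have := hχ.isClassFun_charValue g k⁻¹
  rw [coeff_conj, eQ_coeff, eQ_coeff, ← this]
  simp [mul_assoc]

theorem IsIrrChar.eQ_ne_zero (hχ : IsIrrChar χ) : eQ χ ≠ 0 := by
  obtain ⟨hf, hg⟩ := charField_galois hχ
  have := Fintype.ofFinite Gal(charField χ/ℚ)
  classical
  intro h
  have h1 := congrArg (MonoidAlgebra.mapRingHom G (algebraMap ℚ (charField χ))) h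
  rw [hχ.map_eQ, map_zero] at h1
  have h2 := congrArg (eF χ * ·) h1
  simp only [Finset.mul_sum, mul_zero] at h2
  rw [Finset.sum_eq_single 1 (fun τ _ hτ => hχ.eF_mul_eGal hτ) (by simp), eGal_one,
    hχ.eF_mul_self] at h2
  exact hχ.eF_ne_zero h2

/-- A central idempotent acts on `eF χ` by a scalar equal to its square, so by `0` or `1`. Since `z`
is rational, the Galois group fixes it and the same scalar occurs on every `eGal χ σ`. -/
theorem IsIrrChar.mul_eQ_eq_zero_or (hχ : IsIrrChar χ) {z : MonoidAlgebra ℚ G}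
    (hz : ∀ g, conj z g = z) (hi : IsIdempotentElem z) : z * eQ χ = 0 ∨ z * eQ χ = eQ χ := by
  obtain ⟨hf, hg⟩ := charField_galois hχ
  have := Fintype.ofFinite Gal(charField χ/ℚ)
  set F := charField χ
  set w := MonoidAlgebra.mapRingHom G (algebraMap ℚ F) z with hw
  have hc : IsClassFun fun g => w.coeff g := fun g k => by
    simp only [hw, coeff_mapRingHom]
    rw [← coeff_conj, hz]
  have hwi : w * w = w := by rw [hw, ← map_mul, hi]
  obtain ⟨ω, hω⟩ := hχ.exists_mul_eF hc
  have hfix : ∀ σ : Gal(F/ℚ), MonoidAlgebra.mapRingHom G (σ : F →+* F) w = w := fun σ =>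
    ext_coeff fun g => σ.commutes _
  have h2 : (ω * ω) • eF χ = ω • eF χ := by
    rw [mul_smul, ← hω, ← mul_smul_comm, ← hω, ← mul_assoc, hwi]
  have h3 : (ω * ω - ω) • eF χ = 0 := by rw [sub_smul, h2, sub_self]
  have h4 : ω * (ω - 1) = 0 := by
    obtain ⟨g, hg⟩ : ∃ g, (eF χ).coeff g ≠ 0 := by
      by_contra! hc
      exact hχ.eF_ne_zero (ext_coeff hc)
    have := congrArg (fun y => y.coeff g) h3
    rw [mul_sub_one]
    simpa only [MonoidAlgebra.coeff_smul_apply, smul_eq_mul, MonoidAlgebra.coeff_zero,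
      Finsupp.coe_zero, Pi.zero_apply, mul_eq_zero, hg, or_false] using this
  have hmul : ∀ σ, w * eGal χ σ = MonoidAlgebra.mapRingHom G (σ : F →+* F) (w * eF χ) :=
    fun σ => by rw [map_mul, hfix]; rfl
  rcases mul_eq_zero.1 h4 with h | h
  · left
    apply mapRingHom_algebraMap_injective (F := F)
    rw [map_mul, hχ.map_eQ, ← hw, Finset.mul_sum, map_zero]
    refine Finset.sum_eq_zero fun σ _ => ?_
    rw [hmul, hω, h, zero_smul, map_zero]
  · right
    apply mapRingHom_algebraMap_injective (F := F)
    rw [map_mul, hχ.map_eQ, ← hw, Finset.mul_sum]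
    refine Finset.sum_congr rfl fun σ _ => ?_
    rw [hmul, hω, sub_eq_zero.1 h, one_smul]
    rfl

theorem IsIrrChar.isPrimCentralIdem_eQ (hχ : IsIrrChar χ) : IsPrimCentralIdem (eQ χ) := by
  refine ⟨mem_center_iff_conj.2 hχ.conj_eQ, hχ.isIdempotentElem_eQ, hχ.eQ_ne_zero, ?_⟩
  intro f g hf hfi hg hgi hfg he
  have h1 : f * eQ χ = f := by rw [he, mul_add, hfg, add_zero, hfi]
  rcases hχ.mul_eQ_eq_zero_or (mem_center_iff_conj.1 hf) hfi with h | h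
  · left; rw [← h1, h]
  · right
    rw [h1] at h
    rw [← h] at he
    simpa using he.symm

end GaloisOrbit

/-! ### Linear characters extended by zero. -/

section ExtendByZero

variable {G : Type*} [Group G] {H : Subgroup G}

open scoped Classical in
/-- The extension by zero to `G` of a linear character of a subgroup `H`. -/
def ext0 (ψ : H →* ℂˣ) (g : G) : ℂ := if h : g ∈ H then ψ ⟨g, h⟩ else 0

theorem ext0_of_mem (ψ : H →* ℂˣ) {g : G} (h : g ∈ H) : ext0 ψ g = ψ ⟨g, h⟩ := dif_pos h

theorem ext0_of_notMem (ψ : H →* ℂˣ) {g : G} (h : g ∉ H) : ext0 ψ g = 0 := dif_neg h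

theorem ext0_mul_left (ψ : H →* ℂˣ) {m : G} (hm : m ∈ H) (g : G) :
    ext0 ψ (m * g) = ext0 ψ m * ext0 ψ g := by
  by_cases hg : g ∈ H
  · rw [ext0_of_mem ψ hm, ext0_of_mem ψ hg, ext0_of_mem ψ (H.mul_mem hm hg), ← Units.val_mul,
      ← map_mul]
    rfl
  · rw [ext0_of_notMem ψ hg, mul_zero, ext0_of_notMem]
    rwa [H.mul_mem_cancel_left hm]

theorem ext0_mul_right (ψ : H →* ℂˣ) {m : G} (hm : m ∈ H) (g : G) :
    ext0 ψ (g * m) = ext0 ψ g * ext0 ψ m := by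
  by_cases hg : g ∈ H
  · rw [ext0_mul_left ψ hg]
  · rw [ext0_of_notMem ψ hg, zero_mul, ext0_of_notMem]
    rwa [H.mul_mem_cancel_right hm]

theorem ext0_one (ψ : H →* ℂˣ) : ext0 ψ 1 = 1 := by
  rw [ext0_of_mem ψ H.one_mem]
  exact congrArg Units.val ψ.map_one

theorem ext0_mul_inv (ψ : H →* ℂˣ) {m : G} (hm : m ∈ H) : ext0 ψ m * ext0 ψ m⁻¹ = 1 := by
  rw [← ext0_mul_left ψ hm, mul_inv_cancel, ext0_one]

theorem ext0_pow (ψ : H →* ℂˣ) (j : ℕ) {g : G} (hg : g ∈ H) :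
    ext0 (ψ ^ j) g = ext0 ψ g ^ j := by
  rw [ext0_of_mem _ hg, ext0_of_mem _ hg, MonoidHom.pow_apply, Units.val_pow_eq_pow_val]

theorem linKer_le (ψ : H →* ℂˣ) : linKer ψ ≤ H := Subgroup.map_subtype_le _

theorem mem_linKer (ψ : H →* ℂˣ) {g : G} : g ∈ linKer ψ ↔ ext0 ψ g = 1 := by
  constructor
  · rintro ⟨h, hh, rfl⟩
    change ext0 ψ (h : G) = 1
    rw [ext0_of_mem ψ h.2]
    exact congrArg Units.val (MonoidHom.mem_ker.1 hh)
  · intro h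
    by_cases hg : g ∈ H
    · rw [ext0_of_mem ψ hg, Units.val_eq_one] at h
      exact ⟨⟨g, hg⟩, h, rfl⟩
    · rw [ext0_of_notMem ψ hg] at h
      exact absurd h zero_ne_one

theorem linInd_apply [Fintype G] (ψ : H →* ℂˣ) (g : G) :
    linInd ψ g = (Nat.card H : ℂ)⁻¹ * ∑ x : G, ext0 ψ (x * g * x⁻¹) := by
  rw [linInd, inducedChar, finsum_eq_sum_of_fintype]
  congr

theorem ext0_linOn {L : Subgroup G} (hHL : H ≤ L) (ψ : H →* ℂˣ) (l : L) :
    ext0 (linOn hHL ψ) l = ext0 ψ (l : G) := by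
  by_cases h : (l : G) ∈ H
  · rw [ext0_of_mem ψ h, ext0_of_mem _ (Subgroup.mem_subgroupOf.2 h)]
    rfl
  · rw [ext0_of_notMem ψ h, ext0_of_notMem _ (by rwa [Subgroup.mem_subgroupOf])]

theorem linKer_linOn {L : Subgroup G} (hHL : H ≤ L) (ψ : H →* ℂˣ) :
    linKer (linOn hHL ψ) = (linKer ψ).subgroupOf L := by
  ext l
  rw [mem_linKer, ext0_linOn, Subgroup.mem_subgroupOf, mem_linKer]

theorem range_linOn {L : Subgroup G} (hHL : H ≤ L) (ψ : H →* ℂˣ) :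
    (linOn hHL ψ).range = ψ.range := by
  rw [linOn, MonoidHom.range_comp, MonoidHom.range_eq_top.2, ← MonoidHom.range_eq_map]
  exact (Subgroup.subgroupOfEquivOfLe hHL).surjective

end ExtendByZero

/-! ### Idempotents of linear characters and of subgroups. -/

section LinearIdempotent

variable {G : Type*} [Group G] {H : Subgroup G}

/-- Extension of scalars `ℚG → ℂG`. -/
abbrev toC : MonoidAlgebra ℚ G →+* MonoidAlgebra ℂ G :=
  MonoidAlgebra.mapRingHom G (algebraMap ℚ ℂ)

theorem toC_hat (M : Subgroup G) [Fintype M] :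
    toC (hat M) = (Nat.card M : ℂ)⁻¹ • ∑ m : M, MonoidAlgebra.single (m : G) (1 : ℂ) := by
  refine ext_coeff fun g => ?_
  rw [coeff_mapRingHom, hat, finsum_eq_sum_of_fintype]
  simp only [MonoidAlgebra.coeff_smul_apply, MonoidAlgebra.coeff_sum, Finsupp.finsetSum_apply,
    MonoidAlgebra.coeff_single, smul_eq_mul, map_mul, map_inv₀, map_natCast, map_sum]
  congr 1
  refine Finset.sum_congr rfl fun m _ => ?_
  classical
  rw [Finsupp.single_apply, Finsupp.single_apply]
  split_ifs <;> simp

theorem sum_ext0 (ψ : H →* ℂˣ) {M : Subgroup G} [Fintype M] (hM : M ≤ H) (h : ¬ M ≤ linKer ψ) :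
    ∑ m : M, ext0 ψ (m : G) = 0 := by
  classical
  let φ : M →* ℂ := (Units.coeHom ℂ).comp (ψ.comp (Subgroup.inclusion hM))
  have hφ : ∀ m : M, ext0 ψ (m : G) = φ m := fun m => ext0_of_mem ψ (hM m.2)
  simp only [hφ]
  rw [sum_hom_units, if_neg, Nat.cast_zero]
  intro h1
  refine h fun m hm => (mem_linKer ψ).2 ?_
  rw [hφ ⟨m, hm⟩, h1, MonoidHom.one_apply]

theorem card_eq_card_range_mul (ψ : H →* ℂˣ) :
    Nat.card H = Nat.card ψ.range * Nat.card (linKer ψ) := by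
  have h1 : Nat.card (linKer ψ) = Nat.card ψ.ker :=
    Subgroup.card_map_of_injective H.subtype_injective
  rw [h1, ← Subgroup.index_ker, mul_comm, Subgroup.card_mul_index]

theorem pow_card_range (ψ : H →* ℂˣ) (h : H) : ψ h ^ Nat.card ψ.range = 1 := by
  have : (⟨ψ h, h, rfl⟩ : ψ.range) ^ Nat.card ψ.range = 1 := pow_card_eq_one'
  exact congrArg Subtype.val this

theorem linKer_le_linKer_pow (ψ : H →* ℂˣ) (j : ℕ) : linKer ψ ≤ linKer (ψ ^ j) := fun g hg => by
  rw [mem_linKer] at *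
  have : g ∈ H := linKer_le ψ ((mem_linKer ψ).2 hg)
  rw [ext0_pow ψ j this, hg, one_pow]

theorem linKer_pow_of_coprime (ψ : H →* ℂˣ) {j : ℕ} (hj : j.Coprime (Nat.card ψ.range)) :
    linKer (ψ ^ j) = linKer ψ := by
  refine le_antisymm (fun g hg => ?_) (linKer_le_linKer_pow ψ j)
  have hH := linKer_le _ hg
  rw [mem_linKer, ext0_pow ψ j hH, ext0_of_mem ψ hH, ← Units.val_pow_eq_pow_val,
    Units.val_eq_one] at hg
  rw [mem_linKer, ext0_of_mem ψ hH, Units.val_eq_one]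
  have := pow_gcd_eq_one.2 ⟨hg, pow_card_range ψ ⟨g, hH⟩⟩
  rwa [hj, pow_one] at this

theorem linKer_normal (ψ : H →* ℂˣ) : ((linKer ψ).subgroupOf H).Normal := by
  have : (linKer ψ).subgroupOf H = ψ.ker := by
    ext h
    rw [Subgroup.mem_subgroupOf, mem_linKer, ext0_of_mem ψ h.2, Units.val_eq_one]
    rfl
  rw [this]
  infer_instance

variable [Fintype G]

theorem finite_range_lin (ψ : H →* ℂˣ) : Finite ψ.range :=
  Finite.of_surjective ψ.rangeRestrict ψ.rangeRestrict_surjective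

/-- The idempotent `|H|⁻¹ ∑ ψ(h) h⁻¹` of a linear character of `H`. -/
def eLin (ψ : H →* ℂˣ) : MonoidAlgebra ℂ G := ofFun fun g => (Nat.card H : ℂ)⁻¹ * ext0 ψ g⁻¹

theorem single_mul_eLin (ψ : H →* ℂˣ) {m : G} (hm : m ∈ H) :
    MonoidAlgebra.single m 1 * eLin ψ = ext0 ψ m • eLin ψ := by
  refine ext_coeff fun g => ?_
  rw [MonoidAlgebra.coeff_single_mul_apply, MonoidAlgebra.coeff_smul_apply, eLin, coeff_ofFun,
    coeff_ofFun, mul_inv_rev, inv_inv, ext0_mul_right ψ hm, smul_eq_mul]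
  ring

theorem toC_hat_mul_eLin_of_le (ψ : H →* ℂˣ) {M : Subgroup G} (h : M ≤ linKer ψ) :
    toC (hat M) * eLin ψ = eLin ψ := by
  have := Fintype.ofFinite M
  have h1 : ∀ m : M, MonoidAlgebra.single (m : G) 1 * eLin ψ = eLin ψ := fun m => by
    rw [single_mul_eLin ψ (linKer_le ψ (h m.2)), (mem_linKer ψ).1 (h m.2), one_smul]
  rw [toC_hat, smul_mul_assoc, Finset.sum_mul, Finset.sum_congr rfl fun m _ => h1 m,
    Finset.sum_const, Finset.card_univ, ← Nat.card_eq_fintype_card, ← Nat.cast_smul_eq_nsmul ℂ,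
    smul_smul, inv_mul_cancel₀ (by exact_mod_cast Nat.card_pos.ne'), one_smul]

theorem toC_hat_mul_eLin_of_not_le (ψ : H →* ℂˣ) {M : Subgroup G} (hM : M ≤ H)
    (h : ¬ M ≤ linKer ψ) : toC (hat M) * eLin ψ = 0 := by
  have := Fintype.ofFinite M
  rw [toC_hat, smul_mul_assoc, Finset.sum_mul,
    Finset.sum_congr rfl fun m _ => single_mul_eLin ψ (hM m.2), ← Finset.sum_smul,
    sum_ext0 ψ hM h, zero_smul, smul_zero]

theorem hat_mul_hat {K M : Subgroup G} (h : K ≤ M) : hat M * hat K = hat M := by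
  have := Fintype.ofFinite K
  have := Fintype.ofFinite M
  have h1 : ∀ k : K, hat M * MonoidAlgebra.single (k : G) 1 = hat M := fun k => by
    rw [hat, finsum_eq_sum_of_fintype, smul_mul_assoc, Finset.sum_mul]
    congr 1
    refine Fintype.sum_equiv (Equiv.mulRight ⟨k, h k.2⟩) _ _ fun m => ?_
    simp [MonoidAlgebra.single_mul_single]
  rw [hat.eq_def K, finsum_eq_sum_of_fintype, mul_smul_comm, Finset.mul_sum,
    Finset.sum_congr rfl fun k _ => h1 k,
    Finset.sum_const, Finset.card_univ, ← Nat.card_eq_fintype_card, ← Nat.cast_smul_eq_nsmul ℚ,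
    smul_smul, inv_mul_cancel₀ (by exact_mod_cast Nat.card_pos.ne'), one_smul]

theorem coeff_hat (M : Subgroup G) (g : G) [Decidable (g ∈ M)] :
    (hat M).coeff g = if g ∈ M then (Nat.card M : ℚ)⁻¹ else 0 := by
  classical
  have := Fintype.ofFinite M
  rw [hat, finsum_eq_sum_of_fintype, MonoidAlgebra.coeff_smul_apply, MonoidAlgebra.coeff_sum,
    Finsupp.finsetSum_apply]
  simp only [MonoidAlgebra.coeff_single, Finsupp.single_apply, smul_eq_mul]
  split_ifs with h
  · rw [Finset.sum_eq_single ⟨g, h⟩ (fun b _ hb => if_neg fun e => hb (Subtype.ext e)) (by simp)]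
    simp
  · rw [Finset.sum_eq_zero fun b _ => if_neg fun e => h (by rw [← e]; exact b.2), mul_zero]

/-- The powers of `ψ` are all the characters of the cyclic group `H / linKer ψ`. On coefficients the
identity is a geometric sum in `ψ(g⁻¹)`, which vanishes unless `g` lies in the kernel. -/
theorem toC_hat_linKer (ψ : H →* ℂˣ) :
    toC (hat (linKer ψ)) = ∑ j ∈ Finset.range (Nat.card ψ.range), eLin (ψ ^ j) := by
  classical
  refine ext_coeff fun g => ?_
  rw [coeff_mapRingHom, coeff_hat, MonoidAlgebra.coeff_sum, Finsupp.finsetSum_apply]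
  simp only [eLin, coeff_ofFun, ← Finset.mul_sum]
  have hH : (Nat.card H : ℂ) = Nat.card ψ.range * Nat.card (linKer ψ) := by
    exact_mod_cast card_eq_card_range_mul ψ
  have := finite_range_lin ψ
  have hr : (Nat.card ψ.range : ℂ) ≠ 0 := by exact_mod_cast Nat.card_pos.ne'
  have hk : (Nat.card (linKer ψ) : ℂ) ≠ 0 := by exact_mod_cast Nat.card_pos.ne'
  by_cases hg : g ∈ H
  · have hg' := H.inv_mem hg
    simp only [ext0_pow ψ _ hg']
    by_cases h : g ∈ linKer ψ
    · rw [if_pos h, (mem_linKer ψ).1 ((linKer ψ).inv_mem h), hH]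
      simp only [one_pow, Finset.sum_const, Finset.card_range, nsmul_eq_mul, mul_one, map_inv₀,
        map_natCast]
      field_simp
    · have hw : ext0 ψ g⁻¹ ≠ 1 := fun hw => h (by simpa using (mem_linKer ψ).2 hw)
      have hp : ext0 ψ g⁻¹ ^ Nat.card ψ.range = 1 := by
        rw [ext0_of_mem ψ hg', ← Units.val_pow_eq_pow_val, pow_card_range, Units.val_one]
      rw [if_neg h, geom_sum_eq hw, hp]
      simp
  · have hg' : g⁻¹ ∉ H := by simpa using hg
    rw [if_neg fun h => hg (linKer_le ψ h)]
    simp [ext0_of_notMem _ hg']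

theorem exists_generator_range (ψ : H →* ℂˣ) :
    ∃ h : H, ∀ k : H, ∃ i : ℕ, ψ k = ψ h ^ i := by
  have := finite_range_lin ψ
  obtain ⟨⟨_, h, rfl⟩, hg⟩ := IsCyclic.exists_generator (α := ψ.range)
  refine ⟨h, fun k => ?_⟩
  obtain ⟨i, hi⟩ := (mem_powers_iff_mem_zpowers).2 (hg ⟨ψ k, k, rfl⟩)
  exact ⟨i, (congrArg Subtype.val hi).symm⟩

theorem exists_isPrimitiveRoot (ψ : H →* ℂˣ) :
    ∃ h : H, IsPrimitiveRoot (ψ h) (Nat.card ψ.range) ∧ ∀ k : H, ∃ i : ℕ, ψ k = ψ h ^ i := by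
  obtain ⟨h, hh⟩ := exists_generator_range ψ
  refine ⟨h, ?_, hh⟩
  have hz : Subgroup.zpowers (ψ h) = ψ.range := by
    apply le_antisymm
    · rw [Subgroup.zpowers_le]
      exact ⟨h, rfl⟩
    · rintro _ ⟨k, rfl⟩
      obtain ⟨i, hi⟩ := hh k
      rw [hi]
      exact Subgroup.npow_mem_zpowers _ _
  rw [← hz, Nat.card_zpowers]
  exact IsPrimitiveRoot.orderOf _

/-- If `ψ h` generates the image, of order `n`, then `h ^ (n / gcd(j,n))` lies in the kernel of `ψ ^
j`; it lies in that of `ψ` only when the gcd is `1`. -/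
theorem linKer_pow_of_not_coprime (ψ : H →* ℂˣ) {j : ℕ} (hj : ¬ j.Coprime (Nat.card ψ.range)) :
    linKer ψ < linKer (ψ ^ j) := by
  refine lt_of_le_of_ne (linKer_le_linKer_pow ψ j) fun he => hj ?_
  have := finite_range_lin ψ
  obtain ⟨h, hp, -⟩ := exists_isPrimitiveRoot ψ
  set n := Nat.card ψ.range
  obtain ⟨a, ha⟩ := Nat.gcd_dvd_left j n
  obtain ⟨b, hb⟩ := Nat.gcd_dvd_right j n
  have hn : 0 < n := Nat.card_pos
  have h1 : ((h ^ b : H) : G) ∈ linKer (ψ ^ j) := by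
    rw [mem_linKer, ext0_of_mem _ (h ^ b).2, Units.val_eq_one]
    change ψ (h ^ b) ^ j = 1
    rw [map_pow, ← pow_mul, hp.pow_eq_one_iff_dvd]
    exact ⟨a, by conv_lhs => rw [ha]
                 conv_rhs => rw [hb]
                 ring⟩
  rw [← he, mem_linKer, ext0_of_mem _ (h ^ b).2, Units.val_eq_one] at h1
  change ψ (h ^ b) = 1 at h1
  rw [map_pow, hp.pow_eq_one_iff_dvd] at h1
  have hb0 : 0 < b := Nat.pos_of_ne_zero fun h0 => by rw [h0, mul_zero] at hb; omega
  have hle := Nat.le_of_dvd hb0 h1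
  rw [Nat.Coprime]
  have hg0 : 0 < j.gcd n := Nat.gcd_pos_of_pos_right _ hn
  nlinarith

end LinearIdempotent

/-! ### `ε(H,K)` as a sum over the Galois conjugates of `ψ`. -/

section Epsilon

variable {G : Type*} [Group G] [Fintype G] {H : Subgroup G}

theorem exists_minNormalAbove_le {K N : Subgroup G} (hN : N ≤ H) (hn : (N.subgroupOf H).Normal)
    (hK : K < N) : ∃ M ∈ minNormalAbove H K, M ≤ N := by
  obtain ⟨M, hMN, hM⟩ := (Set.toFinite {M : Subgroup G | M ≤ H ∧ (M.subgroupOf H).Normal ∧ K < M}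
    ).exists_le_minimal ⟨hN, hn, hK⟩
  exact ⟨M, hM, hMN⟩

theorem epsilon_eq_mul_factor {K M : Subgroup G} (hM : M ∈ minNormalAbove H K) :
    ∃ P, epsilon H K = P * (hat K - hat M) := by
  classical
  have hne : H ≠ K := by
    rintro rfl
    exact (hM.1.2.2.trans_le hM.1.1).false
  rw [epsilon, if_neg hne]
  exact ⟨_, (Finset.noncommProd_erase_mul (Set.toFinite (minNormalAbove H K)).toFinset
    (by simpa using hM) (fun M => hat K - hat M) _).symm⟩

theorem epsilon_mul_hat {K : Subgroup G} (hK : K ≤ H) : epsilon H K * hat K = epsilon H K := by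
  by_cases h : H = K
  · rw [epsilon, if_pos h, hat_mul_hat le_rfl]
  -- `H` itself is a candidate, so the product has at least one factor; an empty product would be
  -- `1` and would not absorb `hat K`.
  · obtain ⟨M, hM, -⟩ := exists_minNormalAbove_le le_rfl
      (by rw [Subgroup.subgroupOf_self]; infer_instance) (lt_of_le_of_ne hK (Ne.symm h))
    obtain ⟨P, hP⟩ := epsilon_eq_mul_factor hM
    rw [hP, mul_assoc, sub_mul, hat_mul_hat le_rfl, hat_mul_hat hM.1.2.2.le]

theorem toC_epsilon_mul_eLin_of_eq {K : Subgroup G} (ψ : H →* ℂˣ) (hK : linKer ψ = K) :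
    toC (epsilon H K) * eLin ψ = eLin ψ := by
  rw [epsilon]
  split_ifs with h
  · exact toC_hat_mul_eLin_of_le ψ hK.ge
  · refine Finset.noncommProd_induction _ _ _ (fun x => toC x * eLin ψ = eLin ψ) ?_ ?_ ?_
    · intro a b ha hb
      rw [map_mul, mul_assoc, hb, ha]
    · rw [map_one, one_mul]
    · intro M hM
      have hM' : M ∈ minNormalAbove H K := by simpa using hM
      rw [map_sub, sub_mul, toC_hat_mul_eLin_of_le ψ hK.ge,
        toC_hat_mul_eLin_of_not_le ψ hM'.1.1, sub_zero]
      exact fun hle => (hM'.1.2.2.trans_le (hle.trans hK.le)).false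

theorem toC_epsilon_mul_eLin_of_lt {K : Subgroup G} (ψ : H →* ℂˣ) (hK : K < linKer ψ) :
    toC (epsilon H K) * eLin ψ = 0 := by
  obtain ⟨M, hM, hle⟩ := exists_minNormalAbove_le (linKer_le ψ) (linKer_normal ψ) hK
  obtain ⟨P, hP⟩ := epsilon_eq_mul_factor hM
  rw [hP, map_mul, mul_assoc, map_sub, sub_mul, toC_hat_mul_eLin_of_le ψ hK.le,
    toC_hat_mul_eLin_of_le ψ hle, sub_self, mul_zero]

/-- Expand `ε = ε * hat K` over the powers of `ψ`. If `ψ ^ j` has kernel `K`, every `hat M` kills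
its idempotent and `ε` fixes it. If the kernel is larger, it contains some minimal `M`, and the
factor `hat K - hat M` kills the idempotent. -/
theorem toC_epsilon (ψ : H →* ℂˣ) : toC (epsilon H (linKer ψ)) =
    ∑ j ∈ Finset.range (Nat.card ψ.range) with j.Coprime (Nat.card ψ.range), eLin (ψ ^ j) := by
  rw [← epsilon_mul_hat (linKer_le ψ), map_mul, toC_hat_linKer, Finset.mul_sum, Finset.sum_filter]
  refine Finset.sum_congr rfl fun j _ => ?_
  split_ifs with h
  · exact toC_epsilon_mul_eLin_of_eq _ (linKer_pow_of_coprime ψ h)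
  · exact toC_epsilon_mul_eLin_of_lt _ (linKer_pow_of_not_coprime ψ h)

theorem coeff_epsilon (ψ : H →* ℂˣ) (g : G) : ((epsilon H (linKer ψ)).coeff g : ℂ) =
    (Nat.card H : ℂ)⁻¹ * ∑ j ∈ Finset.range (Nat.card ψ.range) with
      j.Coprime (Nat.card ψ.range), ext0 (ψ ^ j) g⁻¹ := by
  have := congrArg (fun x => x.coeff g) (toC_epsilon ψ)
  simp only [MonoidAlgebra.coeff_sum, Finsupp.finsetSum_apply, eLin, coeff_ofFun,
    ← Finset.mul_sum] at this
  exact this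

/-- By `coeff_epsilon` the coefficients depend only on `H` and `ψ`, so the minimal normal subgroups
need not be transported between `L` and `G`. -/
theorem incl_epsilon {L : Subgroup G} (hHL : H ≤ L) (ψ : H →* ℂˣ) :
    incl L (epsilon (H.subgroupOf L) ((linKer ψ).subgroupOf L)) = epsilon H (linKer ψ) := by
  have := Fintype.ofFinite L
  refine ext_coeff fun g => ?_
  have hc := coeff_epsilon ψ g
  by_cases hg : g ∈ L
  · have := coeff_epsilon (linOn hHL ψ) ⟨g, hg⟩
    rw [linKer_linOn, range_linOn, Nat.card_congr (Subgroup.subgroupOfEquivOfLe hHL).toEquiv]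
      at this
    have he : ∀ j, ext0 ((linOn hHL ψ) ^ j) (⟨g, hg⟩⁻¹ : L) = ext0 (ψ ^ j) g⁻¹ := fun j =>
      ext0_linOn hHL (ψ ^ j) (⟨g, hg⟩⁻¹ : L)
    simp only [he, ← hc] at this
    rw [coeff_incl _ (⟨g, hg⟩ : L)]
    exact_mod_cast this
  · rw [coeff_incl_of_notMem _ hg]
    have hg' : g⁻¹ ∉ H := fun h => hg (by simpa using hHL h)
    simp only [ext0_of_notMem _ hg', Finset.sum_const_zero, mul_zero] at hc
    exact_mod_cast hc.symm

end Epsilon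

/-! ### Traces of roots of unity. -/

section Trace

theorem isCyclotomicExtension_adjoin {n : ℕ} [NeZero n] {ζ : ℂ} (hζ : IsPrimitiveRoot ζ n) :
    IsCyclotomicExtension {n} ℚ (IntermediateField.adjoin ℚ ({ζ} : Set ℂ)) := by
  have halg : IsAlgebraic ℚ ζ := (hζ.isIntegral (NeZero.pos n)).tower_top.isAlgebraic
  change IsCyclotomicExtension {n} ℚ (IntermediateField.adjoin ℚ {ζ}).toSubalgebra
  rw [IntermediateField.adjoin_simple_toSubalgebra_of_isAlgebraic halg]
  exact hζ.adjoin_isCyclotomicExtension ℚ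

theorem sum_units_zmod {M : Type*} [AddCommMonoid M] (n : ℕ) [NeZero n] (f : ℕ → M) :
    ∑ u : (ZMod n)ˣ, f (u : ZMod n).val = ∑ j ∈ Finset.range n with j.Coprime n, f j := by
  refine Finset.sum_bij (fun u _ => (u : ZMod n).val) ?_ ?_ ?_ (fun _ _ => rfl)
  · intro u _
    exact Finset.mem_filter.2 ⟨Finset.mem_range.2 (ZMod.val_lt _), ZMod.val_coe_unit_coprime u⟩
  · intro u _ v _ h
    exact Units.ext (ZMod.val_injective n h)
  · intro j hj
    rw [Finset.mem_filter, Finset.mem_range] at hj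
    exact ⟨ZMod.unitOfCoprime j hj.2, Finset.mem_univ _, by
      rw [ZMod.coe_unitOfCoprime, ZMod.val_cast_of_lt hj.1]⟩

/-- The Galois group is `(ZMod n)ˣ`, acting on `n`-th roots of unity by powers. As `w` need not be
primitive, terms may repeat. -/
theorem trace_of_pow_eq_one {F : Type*} [Field F] [CharZero F] {n : ℕ} [NeZero n]
    [IsCyclotomicExtension {n} ℚ F] {w : F} (hw : w ^ n = 1) :
    algebraMap ℚ F (Algebra.trace ℚ F w) = ∑ j ∈ Finset.range n with j.Coprime n, w ^ j := by
  have : FiniteDimensional ℚ F := IsCyclotomicExtension.finiteDimensional {n} ℚ F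
  have : IsGalois ℚ F := IsCyclotomicExtension.isGalois {n} ℚ F
  have hirr : Irreducible (Polynomial.cyclotomic n ℚ) :=
    Polynomial.cyclotomic.irreducible_rat (NeZero.pos n)
  have hζ := IsCyclotomicExtension.zeta_spec n ℚ F
  obtain ⟨i, -, rfl⟩ := hζ.eq_pow_of_pow_eq_one hw
  rw [trace_eq_sum_automorphisms, ← sum_units_zmod]
  refine Fintype.sum_equiv (IsCyclotomicExtension.autEquivPow F hirr).toEquiv _ _ fun σ => ?_
  have := hζ.autToPow_spec ℚ σ
  rw [map_pow, ← this, ← pow_mul, ← pow_mul, mul_comm]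
  rfl

theorem exists_trace_inclusion {E F : IntermediateField ℚ ℂ} (h : E ≤ F) [FiniteDimensional ℚ F] :
    ∃ m : ℕ, m ≠ 0 ∧ ∀ y : E, Algebra.trace ℚ F (IntermediateField.inclusion h y) =
      m * Algebra.trace ℚ E y := by
  let : Algebra E F := (IntermediateField.inclusion h).toAlgebra
  have : IsScalarTower ℚ E F :=
    IsScalarTower.of_algebraMap_eq fun r => ((IntermediateField.inclusion h).commutes r).symm
  have : FiniteDimensional ℚ E := FiniteDimensional.of_injective
    (IntermediateField.inclusion h).toLinearMap (IntermediateField.inclusion h).injective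
  have : FiniteDimensional E F := FiniteDimensional.right ℚ E F
  refine ⟨Module.finrank E F, Module.finrank_pos.ne', fun y => ?_⟩
  rw [← Algebra.trace_trace (S := E)]
  change Algebra.trace ℚ E (Algebra.trace E F (algebraMap E F y)) = _
  rw [Algebra.trace_algebraMap, map_nsmul, nsmul_eq_mul]

end Trace

/-! ### `eQ` of an induced character in terms of `ε(H,K)`. -/

section InducedIdempotent

variable {G : Type*} [Group G] [Fintype G] {H : Subgroup G}

theorem linInd_one (ψ : H →* ℂˣ) : linInd ψ 1 = (Nat.card G : ℂ) / Nat.card H := by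
  rw [linInd_apply]
  simp [ext0_one, div_eq_inv_mul]

/-- Both sides have coefficients that are traces from `F = ℚ(ζₙ)`: for `ε` by `coeff_epsilon`, for
`eQ` after replacing the trace of `ℚ(ψ^G)` by that of `F`, at the cost of the degree `m`.
Irreducibility plays no role. -/
theorem exists_eQ_linInd (ψ : H →* ℂˣ) :
    ∃ c : ℚ, eQ (linInd ψ) = c • ∑ x, conj (epsilon H (linKer ψ)) x := by
  have := finite_range_lin ψ
  obtain ⟨h₀, hp, hgen⟩ := exists_isPrimitiveRoot ψ
  have hn : NeZero (Nat.card ψ.range) := ⟨Nat.card_pos.ne'⟩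
  set n := Nat.card ψ.range with hn_def
  have hζ : IsPrimitiveRoot (ψ h₀ : ℂ) n := IsPrimitiveRoot.coe_units_iff.2 hp
  set F := IntermediateField.adjoin ℚ ({(ψ h₀ : ℂ)} : Set ℂ) with hF
  have hcyc : IsCyclotomicExtension {n} ℚ F := isCyclotomicExtension_adjoin hζ
  have hfd : FiniteDimensional ℚ F := IsCyclotomicExtension.finiteDimensional {n} ℚ F
  have hmem : ∀ g, ext0 ψ g ∈ F := fun g => by
    by_cases hg : g ∈ H
    · obtain ⟨i, hi⟩ := hgen ⟨g, hg⟩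
      rw [ext0_of_mem ψ hg, hi, Units.val_pow_eq_pow_val]
      exact pow_mem (IntermediateField.mem_adjoin_simple_self ℚ _) i
    · rw [ext0_of_notMem ψ hg]
      exact zero_mem F
  have htr : ∀ g, ((Algebra.trace ℚ F ⟨ext0 ψ g, hmem g⟩ : ℚ) : ℂ) =
      ∑ j ∈ Finset.range n with j.Coprime n, ext0 (ψ ^ j) g := fun g => by
    by_cases hg : g ∈ H
    · have hw : (⟨ext0 ψ g, hmem g⟩ : F) ^ n = 1 := Subtype.ext (by
        change ext0 ψ g ^ n = 1
        rw [ext0_of_mem ψ hg, ← Units.val_pow_eq_pow_val, pow_card_range, Units.val_one])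
      have := congrArg (algebraMap F ℂ) (trace_of_pow_eq_one hw)
      rw [← IsScalarTower.algebraMap_apply] at this
      simp only [ext0_pow ψ _ hg]
      simpa using this
    · have : (⟨ext0 ψ g, hmem g⟩ : F) = 0 := Subtype.ext (ext0_of_notMem ψ hg)
      rw [this, map_zero, Finset.sum_eq_zero fun j _ => ext0_of_notMem _ hg, Rat.cast_zero]
  have hle : charField (linInd ψ) ≤ F := by
    rw [IntermediateField.adjoin_le_iff]
    rintro _ ⟨g, rfl⟩
    rw [linInd_apply]
    exact mul_mem (inv_mem (natCast_mem F _)) (sum_mem fun x _ => hmem _)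
  obtain ⟨m, hm, htm⟩ := exists_trace_inclusion hle
  have hm' : (m : ℚ) ≠ 0 := by exact_mod_cast hm
  have hHc : (Nat.card H : ℚ) ≠ 0 := by exact_mod_cast Nat.card_pos.ne'
  have hGc : (Nat.card G : ℚ) ≠ 0 := by exact_mod_cast Nat.card_pos.ne'
  have hone : ∀ g, charValue (linInd ψ) 1 * charValue (linInd ψ) g =
      ((Nat.card G : ℚ) / Nat.card H) • charValue (linInd ψ) g := fun g => Subtype.ext (by
    rw [IntermediateField.coe_smul]
    change linInd ψ 1 * linInd ψ g = _ • linInd ψ g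
    rw [linInd_one, Algebra.smul_def]
    simp)
  have hval : ∀ g, IntermediateField.inclusion hle (charValue (linInd ψ) g) =
      (Nat.card H : ℚ)⁻¹ • ∑ x : G, (⟨ext0 ψ (x * g * x⁻¹), hmem _⟩ : F) := fun g =>
    Subtype.ext (by
      rw [IntermediateField.coe_smul, IntermediateField.coe_sum]
      change linInd ψ g = _
      rw [linInd_apply, Algebra.smul_def]
      simp)
  have hsum : ∀ g : G, ∑ x : G, Algebra.trace ℚ F ⟨ext0 ψ (x * g⁻¹ * x⁻¹), hmem _⟩ =
      Nat.card H * (∑ x, conj (epsilon H (linKer ψ)) x).coeff g := fun g => by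
    have hHc' : (Nat.card H : ℂ) ≠ 0 := by exact_mod_cast hHc
    rw [MonoidAlgebra.coeff_sum, Finsupp.finsetSum_apply, Finset.mul_sum]
    refine Finset.sum_congr rfl fun x _ => ?_
    have h1 := htr (x * g⁻¹ * x⁻¹)
    have h2 := coeff_epsilon ψ (x * g * x⁻¹)
    rw [coeff_conj]
    have h3 : (x * g * x⁻¹)⁻¹ = x * g⁻¹ * x⁻¹ := by simp [mul_assoc]
    rw [h3, ← hn_def, ← h1, eq_inv_mul_iff_mul_eq₀ hHc'] at h2
    exact_mod_cast h2.symm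
  -- `m` comes from enlarging the field to `F`; `|H|` comes from the degree `|G|/|H|` together with
  -- the factor `1/|G|` in `eQ`.
  refine ⟨(m * Nat.card H : ℚ)⁻¹, ext_coeff fun g => ?_⟩
  have h1 := htm (charValue (linInd ψ) g⁻¹)
  rw [hval, map_smul, map_sum, hsum, smul_eq_mul, inv_mul_cancel_left₀ hHc] at h1
  rw [eQ_coeff, hone, map_smul, MonoidAlgebra.coeff_smul_apply, smul_eq_mul, smul_eq_mul, h1]
  field_simp

end InducedIdempotent

/-! ### Norm one implies irreducible. -/

section NormCriterion

variable {G : Type*} [Group G] [Fintype G] {V : Type*} [AddCommGroup V] [Module ℂ V]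
  [FiniteDimensional ℂ V]

/-- Norm one means that all endomorphisms are scalars. By Maschke every submodule is the range of a
projection, and a scalar has range zero or everything. -/
theorem isIrreducible_of_sum_mul_inv (ρ : Representation ℂ G V)
    (h : ∑ g, ρ.character g * ρ.character g⁻¹ = Nat.card G) : ρ.IsIrreducible := by
  have h0 : (Nat.card G : ℂ) ≠ 0 := by exact_mod_cast Nat.card_pos.ne'
  have : NeZero (Nat.card G : ℂ) := ⟨h0⟩
  have := invertibleOfNonzero h0
  have h1 := Representation.card_inv_mul_sum_char_mul_char_eq_finrank ρ ρ
  rw [h, inv_mul_cancel₀ h0] at h1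
  have h2 : Module.finrank ℂ (Representation.IntertwiningMap ρ ρ) = 1 := by exact_mod_cast h1.symm
  rw [(Representation.IntertwiningMap.equivLinearMapAsModule ρ ρ).finrank_eq] at h2
  rw [Representation.irreducible_iff_isSimpleModule_asModule]
  have hnt : Nontrivial ρ.asModule := by
    by_contra hc
    rw [not_nontrivial_iff_subsingleton] at hc
    rw [Module.finrank_zero_of_subsingleton] at h2
    exact zero_ne_one h2
  have hone : (1 : Module.End (MonoidAlgebra ℂ G) ρ.asModule) ≠ 0 := one_ne_zero
  have : IsSimpleOrder (Submodule (MonoidAlgebra ℂ G) ρ.asModule) :=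
    { exists_pair_ne := ⟨⊥, ⊤, bot_ne_top⟩
      eq_bot_or_eq_top := fun p => by
        obtain ⟨q, hpq⟩ := exists_isCompl p
        obtain ⟨c, hc⟩ := (finrank_eq_one_iff_of_nonzero' _ hone).1 h2 (p.projection q hpq)
        by_cases hc0 : c = 0
        · left
          rw [← Submodule.range_projection hpq, ← hc, hc0, zero_smul, LinearMap.range_zero]
        · right
          rw [← Submodule.range_projection hpq, ← hc, LinearMap.range_eq_top]
          intro v
          refine ⟨c⁻¹ • v, ?_⟩
          rw [LinearMap.smul_apply, Module.End.one_apply, smul_inv_smul₀ hc0] }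
  exact (isSimpleModule_iff _ _).2 this

end NormCriterion

/-! ### The monomial representation affording the induced character. -/

section Monomial

variable {G : Type*} [Group G] [Fintype G] {H : Subgroup G}

theorem exists_transversal (H : Subgroup G) :
    ∃ (n : ℕ) (t : Fin n → G), ∀ g, ∃! i, (t i)⁻¹ * g ∈ H := by
  have := Fintype.ofFinite (G ⧸ H)
  let e := (Fintype.equivFin (G ⧸ H)).symm
  refine ⟨_, fun i => (e i).out, fun g => ⟨e.symm g, ?_, fun i hi => ?_⟩⟩
  · change (e (e.symm g)).out⁻¹ * g ∈ H
    rw [← QuotientGroup.eq]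
    simp
  · change (e i).out⁻¹ * g ∈ H at hi
    rw [← QuotientGroup.eq, QuotientGroup.out_eq'] at hi
    rw [← hi, Equiv.symm_apply_apply]

theorem sum_transversal {n : ℕ} {t : Fin n → G} (ht : ∀ g, ∃! i, (t i)⁻¹ * g ∈ H) {f : G → ℂ}
    (hf : ∀ g, ∀ h ∈ H, f (g * h) = f g) : ∑ x, f x = Nat.card H * ∑ i, f (t i) := by
  classical
  have h1 : ∀ x, f x = ∑ i, if (t i)⁻¹ * x ∈ H then f x else 0 := fun x => by
    obtain ⟨i, hi, hu⟩ := ht x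
    rw [Finset.sum_eq_single i (fun j _ hj => if_neg fun h => hj (hu j h)) (by simp), if_pos hi]
  rw [Finset.sum_congr rfl fun x _ => h1 x, Finset.sum_comm, Finset.mul_sum]
  refine Finset.sum_congr rfl fun i _ => ?_
  have h2 : ∑ x, (if (t i)⁻¹ * x ∈ H then f x else 0) = ∑ y, if y ∈ H then f (t i) else 0 :=
    Fintype.sum_equiv (Equiv.mulLeft (t i)⁻¹) _ _ fun x => by
      by_cases h : (t i)⁻¹ * x ∈ H
      · refine (if_pos h).trans (Eq.trans ?_ (if_pos h).symm)
        rw [← hf (t i) _ h, mul_inv_cancel_left]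
      · exact (if_neg h).trans (if_neg h).symm
  rw [h2, ← Finset.sum_filter, Finset.sum_const, nsmul_eq_mul]
  congr
  rw [← Fintype.card_subtype, ← Nat.card_eq_fintype_card]

/-- The monomial representation of `G` obtained from a linear character of `H` and a left
transversal of `H`. -/
def monomialRep (ψ : H →* ℂˣ) {n : ℕ} (t : Fin n → G) (ht : ∀ g, ∃! i, (t i)⁻¹ * g ∈ H) :
    Representation ℂ G (Fin n → ℂ) where
  toFun g := Matrix.toLin' (Matrix.of fun i k => ext0 ψ ((t i)⁻¹ * g * t k))
  map_one' := by
    rw [Module.End.one_eq_id, ← Matrix.toLin'_one]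
    congr 1
    ext i k
    rw [Matrix.of_apply, mul_one, Matrix.one_apply]
    split_ifs with h
    · rw [h, inv_mul_cancel, ext0_one]
    · exact ext0_of_notMem ψ fun hm => h ((ht (t k)).unique hm (by simp [H.one_mem]))
  map_mul' a b := by
    rw [Module.End.mul_eq_comp, ← Matrix.toLin'_mul]
    congr 1
    ext i k
    rw [Matrix.mul_apply]
    simp only [Matrix.of_apply]
    obtain ⟨j, hj, hu⟩ := ht (b * t k)
    have hj' : (t j)⁻¹ * b * t k ∈ H := by rwa [mul_assoc]
    rw [Finset.sum_eq_single j (fun l _ hl => ?_) (by simp), ← ext0_mul_right ψ hj']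
    · congr 1
      simp [mul_assoc]
    · rw [ext0_of_notMem ψ (g := (t l)⁻¹ * b * t k), mul_zero]
      exact fun h => hl (hu l (by rwa [mul_assoc] at h))

theorem character_monomialRep (ψ : H →* ℂˣ) {n : ℕ} (t : Fin n → G)
    (ht : ∀ g, ∃! i, (t i)⁻¹ * g ∈ H) : (monomialRep ψ t ht).character = linInd ψ := by
  ext g
  have h1 : (monomialRep ψ t ht).character g = ∑ i, ext0 ψ ((t i)⁻¹ * g * t i) :=
    Matrix.trace_toLin'_eq _
  have h2 : ∑ x : G, ext0 ψ (x * g * x⁻¹) = ∑ x : G, ext0 ψ (x⁻¹ * g * x) :=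
    Fintype.sum_equiv (Equiv.inv G) _ _ fun x => by simp
  rw [h1, linInd_apply, h2, sum_transversal ht, inv_mul_cancel_left₀]
  · exact_mod_cast Nat.card_pos.ne'
  · intro x h hh
    have : (x * h)⁻¹ * g * (x * h) = h⁻¹ * ((x⁻¹ * g * x) * h) := by simp [mul_assoc]
    rw [this, ext0_mul_left ψ (H.inv_mem hh), ext0_mul_right ψ hh, mul_left_comm,
      mul_comm (ext0 ψ h⁻¹), ext0_mul_inv ψ hh, mul_one]

theorem isIrrChar_linInd_of_sum (ψ : H →* ℂˣ)
    (h : ∑ g, linInd ψ g * linInd ψ g⁻¹ = Nat.card G) : IsIrrChar (linInd ψ) := by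
  obtain ⟨n, t, ht⟩ := exists_transversal H
  refine ⟨n, monomialRep ψ t ht, isIrreducible_of_sum_mul_inv _ ?_,
    (character_monomialRep ψ t ht).symm⟩
  rw [character_monomialRep, h]

end Monomial

/-! ### Mackey's irreducibility criterion. -/

section Mackey

variable {G : Type*} [Group G] [Fintype G] {H : Subgroup G}

/-- The contribution of the double coset of `x` to the norm of the induced character. -/
def mackey (ψ : H →* ℂˣ) (x : G) : ℂ := ∑ g, ext0 ψ g * ext0 ψ (x * g⁻¹ * x⁻¹)

theorem linInd_conj (ψ : H →* ℂˣ) (g k : G) : linInd ψ (g * k * g⁻¹) = linInd ψ k := by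
  rw [linInd_apply, linInd_apply]
  congr 1
  exact Fintype.sum_equiv (Equiv.mulRight g) _ _ fun x => by simp [mul_assoc]

theorem sum_linInd_mul_inv (ψ : H →* ℂˣ) : ∑ g, linInd ψ g * linInd ψ g⁻¹ =
    Nat.card G / (Nat.card H) ^ 2 * ∑ x, mackey ψ x := by
  have h1 : ∀ y : G, ∑ g, ext0 ψ (y * g * y⁻¹) * linInd ψ g⁻¹ = ∑ g, ext0 ψ g * linInd ψ g⁻¹ :=
    fun y => Fintype.sum_equiv (MulAut.conj y).toEquiv _ _ fun g => by
      have := linInd_conj ψ y g⁻¹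
      simp only [MulEquiv.toEquiv_eq_coe, MulEquiv.coe_toEquiv, MulAut.conj_apply, mul_inv_rev,
        inv_inv]
      rw [← this, mul_assoc y g⁻¹]
  have h2 : ∑ g, ext0 ψ g * linInd ψ g⁻¹ = (Nat.card H : ℂ)⁻¹ * ∑ x, mackey ψ x := by
    simp only [mackey]
    rw [Finset.sum_comm, Finset.mul_sum]
    refine Finset.sum_congr rfl fun g _ => ?_
    rw [linInd_apply, ← Finset.mul_sum, mul_left_comm]
  calc _ = (Nat.card H : ℂ)⁻¹ * ∑ y : G, ∑ g, ext0 ψ (y * g * y⁻¹) * linInd ψ g⁻¹ := by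
        rw [Finset.sum_comm, Finset.mul_sum]
        refine Finset.sum_congr rfl fun g _ => ?_
        rw [linInd_apply ψ g, ← Finset.sum_mul, mul_assoc]
    _ = _ := by
        rw [Finset.sum_congr rfl fun y _ => h1 y, Finset.sum_const, Finset.card_univ,
          ← Nat.card_eq_fintype_card, nsmul_eq_mul, h2]
        ring

theorem mackey_of_mem (ψ : H →* ℂˣ) {x : G} (hx : x ∈ H) : mackey ψ x = Nat.card H := by
  classical
  have h : ∀ g, ext0 ψ g * ext0 ψ (x * g⁻¹ * x⁻¹) = if g ∈ H then 1 else 0 := fun g => by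
    split_ifs with hg
    · rw [ext0_mul_right ψ (H.inv_mem hx), ext0_mul_left ψ hx]
      linear_combination ext0 ψ x * ext0 ψ x⁻¹ * ext0_mul_inv ψ hg + ext0_mul_inv ψ hx
    · rw [ext0_of_notMem ψ hg, zero_mul]
  rw [mackey, Finset.sum_congr rfl fun g _ => h g, Finset.sum_boole, ← Fintype.card_subtype,
    ← Nat.card_eq_fintype_card]

/-- The terms are supported on `D = H ∩ x⁻¹Hx`, where they form a linear character; its sum is `|D|`
or `0`. -/
theorem exists_mackey_eq_natCast (ψ : H →* ℂˣ) (x : G) : ∃ n : ℕ, mackey ψ x = n := by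
  classical
  let D : Subgroup G := H ⊓ H.comap (MulAut.conj x).toMonoidHom
  let c : D →* H := ((MulAut.conj x).toMonoidHom.comp D.subtype).codRestrict H fun d => d.2.2
  let φ : D →* ℂ := (Units.coeHom ℂ).comp
    (ψ.comp (Subgroup.inclusion inf_le_left : D →* H) * (ψ.comp c)⁻¹)
  have hz : ∀ g ∉ D, ext0 ψ g * ext0 ψ (x * g⁻¹ * x⁻¹) = 0 := fun g hg => by
    by_cases h : g ∈ H
    · rw [ext0_of_notMem ψ (g := x * g⁻¹ * x⁻¹), mul_zero]
      intro h'
      refine hg ⟨h, ?_⟩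
      have := H.inv_mem h'
      simpa [mul_assoc] using this
    · rw [ext0_of_notMem ψ h, zero_mul]
  have hD : ∀ d : D, ext0 ψ (d : G) * ext0 ψ (x * (d : G)⁻¹ * x⁻¹) = φ d := fun d => by
    have h1 : x * (d : G)⁻¹ * x⁻¹ = ((c d : H) : G)⁻¹ := by
      change _ = (x * (d : G) * x⁻¹)⁻¹
      simp [mul_assoc]
    rw [ext0_of_mem ψ d.2.1, h1, ext0_of_mem ψ (H.inv_mem (c d).2)]
    change _ = ((ψ ⟨d, d.2.1⟩ * (ψ (c d))⁻¹ : ℂˣ) : ℂ)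
    rw [Units.val_mul, ← map_inv]
    rfl
  refine ⟨if φ = 1 then Fintype.card D else 0, ?_⟩
  rw [← sum_hom_units φ, mackey, ← Finset.sum_subset (Finset.subset_univ (D : Set G).toFinset)
    fun g _ hg => hz g (by simpa using hg)]
  rw [Finset.sum_subtype (p := (· ∈ D)) _ (by simp)]
  exact Finset.sum_congr rfl fun d _ => hD d

/-- Norm one makes the total `|H|²`, which the elements of `H` already contribute. The remaining
terms are natural numbers with sum zero. -/
theorem mackey_eq_zero (ψ : H →* ℂˣ) (hψ : IsIrrChar (linInd ψ)) {x : G} (hx : x ∉ H) :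
    mackey ψ x = 0 := by
  classical
  have h := hψ.sum_mul_inv
  have hH : (Nat.card H : ℂ) ≠ 0 := by exact_mod_cast Nat.card_pos.ne'
  have hG : (Nat.card G : ℂ) ≠ 0 := by exact_mod_cast Nat.card_pos.ne'
  choose m hm using exists_mackey_eq_natCast ψ
  have hmH : ∀ y ∈ H, m y = Nat.card H := fun y hy => by
    exact_mod_cast (hm y).symm.trans (mackey_of_mem ψ hy)
  rw [sum_linInd_mul_inv] at h
  have h1 : ∑ y, mackey ψ y = (Nat.card H : ℂ) ^ 2 := by
    field_simp at h
    exact h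
  have h2 : ∑ y, m y = Nat.card H ^ 2 := by
    rw [Finset.sum_congr rfl fun y _ => hm y] at h1
    exact_mod_cast h1
  rw [← Finset.sum_filter_add_sum_filter_not Finset.univ (· ∈ H),
    Finset.sum_congr rfl fun y hy => hmH y (Finset.mem_filter.1 hy).2, Finset.sum_const,
    ← Fintype.card_subtype, ← Nat.card_eq_fintype_card, smul_eq_mul, sq] at h2
  have h3 : ∑ y with y ∉ H, m y = 0 := by
    have : Nat.card {y // y ∈ H} = Nat.card H := rfl
    rw [this] at h2
    omega
  rw [hm, Finset.sum_eq_zero_iff.1 h3 x (by simpa using hx), Nat.cast_zero]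

theorem isIrrChar_linInd_of_mackey (ψ : H →* ℂˣ) (h : ∀ x ∉ H, mackey ψ x = 0) :
    IsIrrChar (linInd ψ) := by
  classical
  have hH : (Nat.card H : ℂ) ≠ 0 := by exact_mod_cast Nat.card_pos.ne'
  refine isIrrChar_linInd_of_sum ψ ?_
  have h1 : ∀ x, mackey ψ x = if x ∈ H then (Nat.card H : ℂ) else 0 := fun x => by
    split_ifs with hx
    · exact mackey_of_mem ψ hx
    · exact h x hx
  rw [sum_linInd_mul_inv, Finset.sum_congr rfl fun x _ => h1 x, ← Finset.sum_filter,
    Finset.sum_const, ← Fintype.card_subtype, ← Nat.card_eq_fintype_card, nsmul_eq_mul]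
  change (Nat.card G : ℂ) / (Nat.card H : ℂ) ^ 2 * (Nat.card H * Nat.card H) = _
  field_simp

theorem mackey_linOn {L : Subgroup G} [Fintype L] (hHL : H ≤ L) (ψ : H →* ℂˣ) (l : L) :
    mackey (linOn hHL ψ) l = mackey ψ (l : G) := by
  classical
  rw [mackey, mackey, ← Finset.sum_subset (Finset.subset_univ (L : Set G).toFinset)
    fun g _ hg => by
      rw [ext0_of_notMem ψ fun h => hg (by simpa using hHL h), zero_mul],
    Finset.sum_subtype (p := (· ∈ L)) _ (by simp)]
  refine Finset.sum_congr rfl fun k _ => ?_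
  rw [ext0_linOn, ext0_linOn]
  rfl

theorem isIrrChar_linInd_linOn {L : Subgroup G} (hHL : H ≤ L) (ψ : H →* ℂˣ)
    (hψ : IsIrrChar (linInd ψ)) : IsIrrChar (linInd (linOn hHL ψ)) := by
  have := Fintype.ofFinite L
  refine isIrrChar_linInd_of_mackey _ fun l hl => ?_
  rw [mackey_linOn]
  exact mackey_eq_zero ψ hψ fun h => hl (Subgroup.mem_subgroupOf.2 h)

end Mackey

/-! ### Orthogonality of the conjugates of `eQ(ψ^L)`. -/

section Orthogonality

variable {G : Type*} [Group G] {A H L : Subgroup G}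

theorem ext0_linRes (hAH : A ≤ H) (ψ : H →* ℂˣ) {a : G} (ha : a ∈ A) :
    ext0 (linRes hAH ψ) a = ext0 ψ a := by
  rw [ext0_of_mem _ ha, ext0_of_mem _ (hAH ha)]
  rfl

theorem incl_single (l : L) (r : ℚ) :
    incl L (MonoidAlgebra.single l r) = MonoidAlgebra.single (l : G) r :=
  MonoidAlgebra.mapDomain_single

theorem IsInvariantIn.ext0_conj {hA : A.Normal} {hAH : A ≤ H} {ψ : H →* ℂˣ}
    (hinv : IsInvariantIn hA (linRes hAH ψ) L) {x a : G} (hx : x ∈ L) (ha : a ∈ A) :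
    ext0 ψ (x * a * x⁻¹) = ext0 ψ a := by
  rw [← ext0_linRes hAH ψ ha, ← ext0_linRes hAH ψ (hA.conj_mem a ha x),
    ext0_of_mem _ (hA.conj_mem a ha x), ext0_of_mem _ ha, hinv x hx ⟨a, ha⟩]

variable [Finite G]

/-- Invariance lets `A` act through the scalars `ψ_A` in the representation affording `ψ^L`; this is
that fact at the level of characters. -/
theorem IsInvariantIn.linInd_mul {hA : A.Normal} {hAH : A ≤ H} {ψ : H →* ℂˣ}
    (hinv : IsInvariantIn hA (linRes hAH ψ) L) (hHL : H ≤ L) {m : L} (hm : (m : G) ∈ A) (l : L) :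
    linInd (linOn hHL ψ) (l * m) = ext0 ψ (m : G) * linInd (linOn hHL ψ) l := by
  have := Fintype.ofFinite L
  rw [linInd_apply, linInd_apply, mul_left_comm]
  congr 1
  rw [Finset.mul_sum]
  refine Finset.sum_congr rfl fun x _ => ?_
  have h1 : ((x * (l * m) * x⁻¹ : L) : G) = (x * l * x⁻¹ : L) * ((x : G) * m * (x : G)⁻¹) := by
    simp [mul_assoc]
  rw [ext0_linOn, ext0_linOn, h1, ext0_mul_right ψ (hAH (hA.conj_mem _ hm x)),
    hinv.ext0_conj x.2 hm, mul_comm]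

theorem IsInvariantIn.incl_eQ_mul_single {hA : A.Normal} {hAH : A ≤ H} {ψ : H →* ℂˣ}
    (hinv : IsInvariantIn hA (linRes hAH ψ) L) (hHL : H ≤ L) {u : G}
    (hu : u ∈ linKer (linRes hAH ψ)) :
    incl L (eQ (linInd (linOn hHL ψ))) * MonoidAlgebra.single u 1 =
      incl L (eQ (linInd (linOn hHL ψ))) := by
  have := Fintype.ofFinite L
  have huA : u ∈ A := linKer_le _ hu
  have huL : u ∈ L := hHL (hAH huA)
  rw [mem_linKer, ext0_linRes hAH ψ huA] at hu
  rw [← incl_single ⟨u, huL⟩, ← map_mul]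
  congr 1
  refine ext_coeff fun l => ?_
  have h : charValue (linInd (linOn hHL ψ)) (⟨u, huL⟩ * l⁻¹) =
      charValue (linInd (linOn hHL ψ)) l⁻¹ := Subtype.ext (by
    have h1 := linInd_conj (linOn hHL ψ) ⟨u, huL⟩ (l⁻¹ * ⟨u, huL⟩)
    rw [mul_assoc, mul_assoc, mul_inv_cancel, mul_one] at h1
    change linInd _ _ = linInd _ _
    rw [h1, hinv.linInd_mul hHL huA, hu, one_mul])
  rw [MonoidAlgebra.coeff_mul_single_apply, mul_one, eQ_coeff, eQ_coeff, mul_inv_rev, inv_inv, h]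

theorem IsInvariantIn.sum_single_mul_incl_eQ {hA : A.Normal} {hAH : A ≤ H} {ψ : H →* ℂˣ}
    (hinv : IsInvariantIn hA (linRes hAH ψ) L) (hHL : H ≤ L) {M : Subgroup G} [Fintype M]
    (hM : M ≤ A) (h : ¬ M ≤ linKer (linRes hAH ψ)) :
    ∑ m : M, MonoidAlgebra.single (m : G) 1 * incl L (eQ (linInd (linOn hHL ψ))) = 0 := by
  have := Fintype.ofFinite L
  have hL : ∀ m : M, (m : G) ∈ L := fun m => hHL (hAH (hM m.2))
  have h1 : ∀ m : M, MonoidAlgebra.single (m : G) 1 * incl L (eQ (linInd (linOn hHL ψ))) =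
      incl L (MonoidAlgebra.single ⟨m, hL m⟩ 1 * eQ (linInd (linOn hHL ψ))) := fun m => by
    rw [map_mul, incl_single]
  rw [Finset.sum_congr rfl fun m _ => h1 m, ← map_sum]
  refine (congrArg (incl L) (ext_coeff fun l => ?_)).trans (map_zero _)
  rw [MonoidAlgebra.coeff_sum, Finsupp.finsetSum_apply]
  have h2 : ∑ m : M, charValue (linInd (linOn hHL ψ)) (l⁻¹ * ⟨m, hL m⟩) = 0 := Subtype.ext (by
    rw [IntermediateField.coe_sum]
    change ∑ m : M, linInd _ _ = 0
    rw [Finset.sum_congr rfl fun (m : M) _ => hinv.linInd_mul hHL (m := ⟨m, hL m⟩) (hM m.2) l⁻¹,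
      ← Finset.sum_mul]
    have := sum_ext0 (linRes hAH ψ) hM h
    rw [Finset.sum_congr rfl fun (m : M) _ => ext0_linRes hAH ψ (hM m.2)] at this
    rw [this, zero_mul])
  simp only [MonoidAlgebra.coeff_single_mul_apply, eQ_coeff, mul_inv_rev, inv_inv, one_mul]
  rw [← Finset.mul_sum, ← map_sum, ← Finset.mul_sum, h2, mul_zero, map_zero, mul_zero]
  rfl

/-- With `M = U^g`, the element `e^g` absorbs `M` on the right, so `|M| e^g e = e^g (∑ m) e`, and
the sum over `M` kills `e` because `ψ_A` is nontrivial on `M`. -/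
theorem IsInvariantIn.conj_mul_eq_zero_of_notMem {hA : A.Normal} {hAH : A ≤ H} {ψ : H →* ℂˣ}
    (hinv : IsInvariantIn hA (linRes hAH ψ) L) (hHL : H ≤ L) {g : G}
    (hg : g ∉ Subgroup.normalizer (linKer (linRes hAH ψ))) :
    conj (incl L (eQ (linInd (linOn hHL ψ)))) g * incl L (eQ (linInd (linOn hHL ψ))) = 0 := by
  set U := linKer (linRes hAH ψ)
  set e := incl L (eQ (linInd (linOn hHL ψ)))
  let M : Subgroup G := U.map (MulAut.conj g⁻¹).toMonoidHom
  have := Fintype.ofFinite M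
  have hMA : M ≤ A := by
    rintro _ ⟨u, hu, rfl⟩
    exact hA.conj_mem u (linKer_le _ hu) g⁻¹
  -- `M` and `U` have the same order, so containment would be equality and `g` would normalize `U`.
  have hMU : ¬ M ≤ U := by
    intro hle
    have hcard : Nat.card M = Nat.card U :=
      Subgroup.card_map_of_injective (MulAut.conj g⁻¹).injective
    have heq : M = U := Subgroup.eq_of_le_of_card_ge hle hcard.ge
    refine hg (inv_mem_iff.1 (Subgroup.mem_normalizer_iff.2 fun u => ⟨fun hu => ?_, fun hu => ?_⟩))
    · rw [← heq]
      exact ⟨u, hu, rfl⟩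
    · rw [← heq] at hu
      obtain ⟨v, hv, hvu⟩ := hu
      rwa [← (MulAut.conj g⁻¹).injective hvu]
  have hm : ∀ m : M, conj e g * MonoidAlgebra.single (m : G) 1 = conj e g := by
    rintro ⟨_, u, hu, rfl⟩
    have h1 := congrArg (conj · g) (hinv.incl_eQ_mul_single hHL hu)
    simp only [conj_mul] at h1
    have h2 : conj (MonoidAlgebra.single u 1) g = MonoidAlgebra.single (g⁻¹ * u * g) 1 := by
      simp [conj, MonoidAlgebra.single_mul_single]
    rw [h2] at h1
    have h3 : (MulAut.conj g⁻¹).toMonoidHom u = g⁻¹ * u * g := by simp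
    change conj e g * MonoidAlgebra.single ((MulAut.conj g⁻¹).toMonoidHom u) 1 = _
    rw [h3]
    exact h1
  have h0 := congrArg (conj e g * ·) (hinv.sum_single_mul_incl_eQ hHL hMA hMU)
  simp only [Finset.mul_sum, ← mul_assoc, hm, mul_zero, Finset.sum_const, Finset.card_univ] at h0
  exact (smul_eq_zero.1 h0).resolve_left Fintype.card_ne_zero

theorem conj_incl_eQ_of_mem {χ : L → ℂ} (hχ : IsIrrChar χ) {l : G} (hl : l ∈ L) :
    conj (incl L (eQ χ)) l = incl L (eQ χ) := by
  have := Fintype.ofFinite L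
  rw [← incl_conj _ ⟨l, hl⟩, hχ.conj_eQ]

theorem conj_incl_eQ_mul {χ : L → ℂ} (hχ : IsIrrChar χ) {N : Subgroup G} (hLN : L ≤ N)
    (hLn : (L.subgroupOf N).Normal) {g : G} (hg : g ∈ N) :
    (conj (incl L (eQ χ)) g * incl L (eQ χ) = 0 ∨
      conj (incl L (eQ χ)) g * incl L (eQ χ) = incl L (eQ χ)) ∧
    conj (incl L (eQ χ)) g * incl L (eQ χ) = incl L (eQ χ) * conj (incl L (eQ χ)) g := by
  have := Fintype.ofFinite L
  have hnorm : ∀ l, l ∈ L ↔ g * l * g⁻¹ ∈ L := by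
    have h1 : ∀ k ∈ N, ∀ l ∈ L, k * l * k⁻¹ ∈ L := fun k hk l hl =>
      hLn.conj_mem ⟨l, hLN hl⟩ hl ⟨k, hk⟩
    refine fun l => ⟨h1 g hg l, fun h => ?_⟩
    have := h1 g⁻¹ (N.inv_mem hg) _ h
    simpa [mul_assoc] using this
  -- As `g` normalizes `L`, the conjugate is supported on `L`; it comes from a central idempotent
  -- `w` of `ℚL`.
  obtain ⟨w, hw⟩ := exists_incl_eq (L := L) (z := conj (incl L (eQ χ)) g) (fun k hk => by
    rw [coeff_conj, coeff_incl_of_notMem _ (by rwa [← hnorm])])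
  have hwc : ∀ l, conj w l = w := fun l => incl_injective (by
    rw [incl_conj, hw, conj_conj]
    have : g * (l : G) = (g * l * g⁻¹) * g := by simp
    rw [this, ← conj_conj, conj_incl_eQ_of_mem hχ ((hnorm l).1 l.2)])
  have hwi : IsIdempotentElem w := incl_injective (by
    rw [map_mul, hw, ← conj_mul, ← map_mul, hχ.isIdempotentElem_eQ])
  rw [← hw, ← map_mul, ← map_mul]
  constructor
  · rcases hχ.mul_eQ_eq_zero_or hwc hwi with h | h
    · left; rw [h, map_zero]
    · right; rw [h]
  · rw [(Semigroup.mem_center_iff.1 (mem_center_iff_conj.2 hχ.conj_eQ)) w]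

/-- The product `e^g e` is `0` or `e`. The same dichotomy for `g⁻¹`, conjugated by `g`, makes it `0`
or `e^g`. If it is nonzero, then `e^g = e`. -/
theorem conj_incl_eQ_mul_eq_zero {χ : L → ℂ} (hχ : IsIrrChar χ) {N : Subgroup G} (hLN : L ≤ N)
    (hLn : (L.subgroupOf N).Normal) {g : G} (hg : g ∈ N)
    (hne : conj (incl L (eQ χ)) g ≠ incl L (eQ χ)) :
    conj (incl L (eQ χ)) g * incl L (eQ χ) = 0 := by
  obtain ⟨h1, hc⟩ := conj_incl_eQ_mul hχ hLN hLn hg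
  obtain ⟨h2, -⟩ := conj_incl_eQ_mul hχ hLN hLn (N.inv_mem hg)
  have h3 : conj (conj (incl L (eQ χ)) g⁻¹ * incl L (eQ χ)) g =
      incl L (eQ χ) * conj (incl L (eQ χ)) g := by
    rw [conj_mul, conj_conj, inv_mul_cancel, conj_one]
  rcases h1 with h1 | h1
  · exact h1
  rcases h2 with h2 | h2
  · rw [hc, ← h3, h2, conj_zero]
  · rw [h2, ← hc, h1] at h3
    exact absurd h3 hne

theorem IsInvariantIn.mul_eq_zero_of_mem_conjugates {hA : A.Normal} {hAH : A ≤ H} {ψ : H →* ℂˣ}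
    (hinv : IsInvariantIn hA (linRes hAH ψ) L) (hHL : H ≤ L)
    (hLN : L ≤ Subgroup.normalizer (linKer (linRes hAH ψ)))
    (hLn : (L.subgroupOf (Subgroup.normalizer (linKer (linRes hAH ψ)))).Normal)
    (hχ : IsIrrChar (linInd (linOn hHL ψ))) {x y : MonoidAlgebra ℚ G}
    (hx : x ∈ conjugates (incl L (eQ (linInd (linOn hHL ψ)))))
    (hy : y ∈ conjugates (incl L (eQ (linInd (linOn hHL ψ))))) (hxy : x ≠ y) : x * y = 0 := by
  obtain ⟨a, rfl⟩ := hx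
  obtain ⟨b, rfl⟩ := hy
  set e := incl L (eQ (linInd (linOn hHL ψ)))
  have h1 : conj e a = conj (conj e (a * b⁻¹)) b := by rw [conj_conj, inv_mul_cancel_right]
  have hne : conj e (a * b⁻¹) ≠ e := fun h => hxy (by rw [h1, h])
  rw [h1, ← conj_mul]
  by_cases hg : a * b⁻¹ ∈ Subgroup.normalizer (linKer (linRes hAH ψ))
  · rw [conj_incl_eQ_mul_eq_zero hχ hLN hLn hg hne, conj_zero]
  · rw [hinv.conj_mul_eq_zero_of_notMem hHL hg, conj_zero]

theorem isIdempotentElem_conjSum {e : MonoidAlgebra ℚ G} (he : IsIdempotentElem e)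
    (h : ∀ x ∈ conjugates e, ∀ y ∈ conjugates e, x ≠ y → x * y = 0) :
    IsIdempotentElem (conjSum e) := by
  rw [conjSum, finsum_mem_eq_finite_toFinset_sum _ (conjugates_finite e), IsIdempotentElem,
    Finset.sum_mul_sum]
  refine Finset.sum_congr rfl fun x hx => ?_
  have hx' : x ∈ conjugates e := by simpa using hx
  rw [Finset.sum_eq_single x (fun y hy hyx => h x hx' y (by simpa using hy) hyx.symm)
    (fun hn => absurd hx hn)]
  obtain ⟨g, rfl⟩ := hx'
  rw [← conj_mul, he]

end Orthogonality

/-! ### Counting conjugates and comparing constants. -/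

section Coefficients

variable {G : Type*} [Group G] {H L : Subgroup G}

/-- Translation by `l` permutes `G`, so each of the `|L|` inner conjugates contributes the same sum.
-/
theorem sum_conj_incl_sum (x : MonoidAlgebra ℚ L) [Fintype G] [Fintype L] :
    ∑ g : G, conj (incl L (∑ l : L, conj x l)) g = (Nat.card L : ℚ) • ∑ g, conj (incl L x) g := by
  have h1 : ∀ l : L, ∑ g : G, conj (incl L (conj x l)) g = ∑ g : G, conj (incl L x) g := fun l =>
    Fintype.sum_equiv (Equiv.mulLeft (l : G)) _ _ fun g => by
      rw [incl_conj, conj_conj]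
      rfl
  simp only [map_sum, conj_sum]
  rw [Finset.sum_comm, Finset.sum_congr rfl fun l _ => h1 l, Finset.sum_const, Finset.card_univ,
    ← Nat.card_eq_fintype_card, Nat.cast_smul_eq_nsmul]

theorem card_eq_card_mul_relIndex {A B : Subgroup G} (h : A ≤ B) :
    Nat.card B = Nat.card A * A.relIndex B := by
  rw [Subgroup.relIndex, ← Subgroup.card_mul_index (A.subgroupOf B),
    Nat.card_congr (Subgroup.subgroupOfEquivOfLe h).toEquiv]

theorem card_cen_incl (x : MonoidAlgebra ℚ L) :
    Nat.card (cen x) = Nat.card (L ⊓ cen (incl L x) : Subgroup G) :=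
  Nat.card_congr
    { toFun := fun l => ⟨l, l.1.2, mem_cen_incl.2 l.2⟩
      invFun := fun g => ⟨⟨g, g.2.1⟩, mem_cen_incl.1 g.2.2⟩
      left_inv := fun _ => rfl
      right_inv := fun _ => rfl }

theorem exists_eQ_eq_smul_conjSum [Finite G] (ψ : H →* ℂˣ) :
    ∃ c : ℚ, eQ (linInd ψ) = (c * Nat.card (cen (epsilon H (linKer ψ)))) • eSum H (linKer ψ) ∧
      eQ (linInd ψ) = c • ∑ᶠ g : G, conj (epsilon H (linKer ψ)) g := by
  have := Fintype.ofFinite G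
  obtain ⟨c, hc⟩ := exists_eQ_linInd ψ
  refine ⟨c, ?_, by rw [hc, finsum_eq_sum_of_fintype]⟩
  rw [hc, sum_conj_eq, smul_smul, eSum]

end Coefficients

end

end Shoda
-- The proposition.
theorem proposition5p3 {G : Type*} [Group G] [Finite G] {A H K L : Subgroup G}
    (hKH : K ≤ H) [hKn : (K.subgroupOf H).Normal] (hcyc : IsCyclic (H ⧸ K.subgroupOf H))
    (ψ : H →* ℂˣ) (hψ : Shoda.linKer ψ = K)
    (hA : A.Normal) (hAH : A ≤ H) (hHL : H ≤ L)
    (hinv : Shoda.IsInvariantIn hA (Shoda.linRes hAH ψ) L)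
    (hLN : L ≤ Subgroup.normalizer (Shoda.linKer (Shoda.linRes hAH ψ)))
    (hLn : (L.subgroupOf (Subgroup.normalizer (Shoda.linKer (Shoda.linRes hAH ψ)))).Normal) :
    (Shoda.IsIrrChar (Shoda.linInd (Shoda.linOn hHL ψ)) →
      ∀ x ∈ Shoda.conjugates (Shoda.incl L (Shoda.eQ (Shoda.linInd (Shoda.linOn hHL ψ)))),
      ∀ y ∈ Shoda.conjugates (Shoda.incl L (Shoda.eQ (Shoda.linInd (Shoda.linOn hHL ψ)))),
        x ≠ y → x * y = 0) ∧
    (Shoda.IsIrrChar (Shoda.linInd ψ) →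
      Shoda.IsIrrChar (Shoda.linInd (Shoda.linOn hHL ψ)) ∧
      Shoda.eQ (Shoda.linInd ψ) =
        Shoda.conjSum (Shoda.incl L (Shoda.eQ (Shoda.linInd (Shoda.linOn hHL ψ)))) ∧
      Shoda.IsPrimCentralIdem (Shoda.alpha H K • Shoda.eSum H K) ∧
      Shoda.IsPrimCentralIdem (Shoda.alpha (H.subgroupOf L) (K.subgroupOf L) •
        Shoda.eSum (H.subgroupOf L) (K.subgroupOf L)) ∧
      Shoda.alpha H K = Shoda.alpha (H.subgroupOf L) (K.subgroupOf L) *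
        (((L ⊓ Shoda.cen (Shoda.epsilon H K)).relIndex (Shoda.cen (Shoda.epsilon H K)) : ℚ) /
          (L.relIndex (Shoda.cen
            (Shoda.incl L (Shoda.eSum (H.subgroupOf L) (K.subgroupOf L)))) : ℚ))) := by
  subst hψ
  refine ⟨fun hχ x hx y hy hxy =>
    hinv.mul_eq_zero_of_mem_conjugates hHL hLN hLn hχ hx hy hxy, fun hG => ?_⟩
  have hfG := Fintype.ofFinite G
  have hfL := Fintype.ofFinite L
  have hL := Shoda.isIrrChar_linInd_linOn hHL ψ hG
  obtain ⟨c, hc, hc'⟩ := Shoda.exists_eQ_eq_smul_conjSum ψ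
  obtain ⟨d, hd, hd'⟩ := Shoda.exists_eQ_eq_smul_conjSum (Shoda.linOn hHL ψ)
  rw [finsum_eq_sum_of_fintype] at hc' hd'
  rw [Shoda.linKer_linOn] at hd hd'
  set K := Shoda.linKer ψ
  set eL := Shoda.eQ (Shoda.linInd (Shoda.linOn hHL ψ))
  set eG := Shoda.eQ (Shoda.linInd ψ)
  have hpG := hG.isPrimCentralIdem_eQ
  have hpL := hL.isPrimCentralIdem_eQ
  change Shoda.IsPrimCentralIdem eG at hpG
  change Shoda.IsPrimCentralIdem eL at hpL
  -- The multiples of `e(G,H,K)` and `e(L,H,K)` found above are primitive central idempotents, so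
  -- uniqueness reads off both values of `alpha`.
  have hαG := Shoda.alpha_eq (hc ▸ hpG)
  have hαL := Shoda.alpha_eq (hd ▸ hpL)
  have hc0 : c ≠ 0 := fun h => hG.eQ_ne_zero (by rw [h, zero_smul] at hc'; exact hc')
  have hd0 : d ≠ 0 := fun h => hL.eQ_ne_zero (by rw [h, zero_smul] at hd'; exact hd')
  have hcard : ∀ (B : Subgroup G), (Nat.card B : ℚ) ≠ 0 := fun B => by
    exact_mod_cast Nat.card_pos.ne'
  have hε : Shoda.incl L (Shoda.epsilon (H.subgroupOf L) (K.subgroupOf L)) = Shoda.epsilon H K :=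
    Shoda.incl_epsilon hHL ψ
  have hsum : (Nat.card (Shoda.cen (Shoda.incl L eL)) : ℚ) • Shoda.conjSum (Shoda.incl L eL) =
      (d * Nat.card L * c⁻¹) • eG := by
    have h1 : ∀ g, Shoda.conj (Shoda.incl L eL) g = d • Shoda.conj (Shoda.incl L
        (∑ l, Shoda.conj (Shoda.epsilon (H.subgroupOf L) (K.subgroupOf L)) l)) g := fun g => by
      rw [hd', map_smul, Shoda.conj_smul]
    rw [← Shoda.sum_conj_eq, Finset.sum_congr rfl fun g _ => h1 g, ← Finset.smul_sum,
      Shoda.sum_conj_incl_sum, hε, hc', smul_smul, smul_smul,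
      inv_mul_cancel_right₀ hc0]
  set r : ℚ := d * Nat.card L * c⁻¹ / Nat.card (Shoda.cen (Shoda.incl L eL)) with hr
  have hs : Shoda.conjSum (Shoda.incl L eL) = r • eG := by
    rw [hr, div_eq_inv_mul, mul_smul, ← hsum, smul_smul, inv_mul_cancel₀ (hcard _), one_smul]
  have hr0 : r ≠ 0 :=
    div_ne_zero (mul_ne_zero (mul_ne_zero hd0 (hcard L)) (inv_ne_zero hc0)) (hcard _)
  -- Orthogonality makes `r • eG` idempotent; as `eG` is a nonzero idempotent, `r * r = r`, and `r ≠
  -- 0`.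
  have hr1 : r = 1 := by
    have hi : IsIdempotentElem (Shoda.incl L eL) := by
      rw [IsIdempotentElem, ← map_mul, hL.isIdempotentElem_eQ]
    have h1 := Shoda.isIdempotentElem_conjSum hi fun x hx y hy hxy =>
      hinv.mul_eq_zero_of_mem_conjugates hHL hLN hLn hL hx hy hxy
    rw [hs, IsIdempotentElem, smul_mul_smul_comm, hG.isIdempotentElem_eQ] at h1
    have h2 := smul_left_injective ℚ hG.eQ_ne_zero h1
    exact mul_left_cancel₀ hr0 (h2.trans (mul_one r).symm)
  have hcen : Shoda.cen (Shoda.incl L (Shoda.eSum (H.subgroupOf L) (K.subgroupOf L))) =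
      Shoda.cen (Shoda.incl L eL) := by
    have hne : d * Nat.card (Shoda.cen (Shoda.epsilon (H.subgroupOf L) (K.subgroupOf L))) ≠ 0 :=
      mul_ne_zero hd0 (by exact_mod_cast Nat.card_pos.ne')
    rw [hd, map_smul, Shoda.cen_smul hne]
  have hLcen : L ≤ Shoda.cen (Shoda.incl L eL) := fun l hl =>
    Shoda.mem_cen_iff.2 (Shoda.conj_incl_eQ_of_mem hL hl)
  refine ⟨hL, by rw [hs, hr1, one_smul], ?_, ?_, ?_⟩
  · rw [hαG, ← hc]
    exact hpG
  · rw [hαL, ← hd]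
    exact hpL
  -- What remains is `c |Cen_G(ε)|` against `d |Cen_L(ε)|`, with `c/d` supplied by `r = 1`.
  · rw [hcen, hαG, hαL, Shoda.card_cen_incl, hε]
    have h1 := Shoda.card_eq_card_mul_relIndex
      (inf_le_right : L ⊓ Shoda.cen (Shoda.epsilon H K) ≤ Shoda.cen (Shoda.epsilon H K))
    have h2 := Shoda.card_eq_card_mul_relIndex hLcen
    have hx := hcard (L ⊓ Shoda.cen (Shoda.epsilon H K))
    have hy := hcard L
    have hz := hcard (Shoda.cen (Shoda.incl L eL))
    rw [hr, h2, Nat.cast_mul] at hr1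
    rw [h2, Nat.cast_mul] at hz
    have hw := (mul_ne_zero_iff.1 hz).2
    rw [h1, Nat.cast_mul]
    field_simp at hr1
    rw [hr1]
    field_simp
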